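/- **Setting.** There are $M$ cameras, $N$ points and a set $\mathcal E$ of (camera, point) pairs; every camera and every point is held by one of the devices $\alpha\in\{1,\dots,S\}$. The unknown $\mathbf x$ consists of $\mathbf c_i=(\mathbf R_i,\mathbf t_i,\mathbf d_i)\in SO(3)\times\mathbb R^3\times\mathbb R^3$ for each camera and $\mathbf l_j\in\mathbb R^3$ for each point, and $\mathbf x^\alpha$ is the part held by device $\alpha$; norms are Euclidean (Frobenius for matrices). Given observations $\mathbf u_{ij}\in\mathbb R^2$, put $$\mathbf p_{ij}=\begin{bmatrix}\mathbf u_{ij}\\ d_{i,1}+d_{i,2}\|\mathbf u_{ij}\|^2+d_{i,3}\|\mathbf u_{ij}\|^4\end{bmatrix},\qquad \mathbf e_{ij}=\Big(\mathbf I-\tfrac{\mathbf R_i^\top(\mathbf l_j-\mathbf t_i)(\mathbf l_j-\mathbf t_i)^\top\mathbf R_i}{\|\mathbf l_j-\mathbf t_i\|^2}\Big)\mathbf p_{ij},$$ $F_{ij}(\mathbf c_i,\mathbf l_j)=\tfrac12\rho(\|\mathbf e_{ij}\|^2)$ and $F(\mathbf x)=\sum_{(i,j)\in\mathcal E}F_{ij}(\mathbf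 c_i,\mathbf l_j)$. **Surrogates.** For a base point $\mathbf y$, let $w_{ij}=\rho'(\|\mathbf e_{ij}\|^2)$, $a_{ij}=\frac12\rho(\|\mathbf e_{ij}\|^2)-\frac12\rho'(\|\mathbf e_{ij}\|^2)\|\mathbf e_{ij}\|^2$, $\lambda_{ij}=(\mathbf l_j-\mathbf t_i)^\top\mathbf R_i\mathbf p_{ij}/\|\mathbf l_j-\mathbf t_i\|^2$ and $\mathbf g_{ij}=\frac12\mathbf R_i\mathbf p_{ij}+\frac12\lambda_{ij}\mathbf t_i+\frac12\lambda_{ij}\mathbf l_j$, all evaluated at $\mathbf y$ (any quotient with denominator $\|\mathbf l_j-\mathbf t_i\|^2=0$ is read as $0$). Let $$P_{ij}(\mathbf c_i|\mathbf y)=w_{ij}\|\mathbf R_i\mathbf p_{ij}+\lambda_{ij}\mathbf t_i-\mathbf g_{ij}\|^2+\tfrac12a_{ij},\qquad Q_{ij}(\mathbf l_j|\mathbf y)=w_{ij}\|\lambda_{ij}\mathbf l_j-\mathbf g_{ij}\|^2+\tfrac12a_{ij}.$$ For $\xi>0$, $E^\alpha(\mathbf x^\alpha|\mathbf y)$ is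 $\frac12\xi\|\mathbf x^\alpha-\mathbf y^\alpha\|^2$, plus the sum of $F_{ij}$ over pairs with camera and point both on $\alpha$, plus the sum of $P_{ij}(\cdot|\mathbf y)$ over pairs with only the camera on $\alpha$, plus the sum of $Q_{ij}(\cdot|\mathbf y)$ over pairs with only the point on $\alpha$. Let $\Delta E^\alpha(\mathbf x|\mathbf y)=-\frac12\xi\|\mathbf x^\alpha-\mathbf y^\alpha\|^2+\frac12\sum(F_{ij}-P_{ij}(\cdot|\mathbf y)-Q_{ij}(\cdot|\mathbf y))$, the sum being over pairs with exactly one member on $\alpha$. **Algorithm (DABA).** Take $\xi>0$ and $0<\eta\le1$. Start from a feasible $\mathbf x^{(0)}=\mathbf x^{(-1)}$ with $s^{(0)}=1$ and $F^{\alpha(-1)}=\overline F^{\alpha(-1)}=E^{\alpha(0)}=E^\alpha(\mathbf x^{\alpha(0)}|\mathbf x^{(0)})$. For $k=0,1,2,\dots$: 1. $s^{(k+1)}=\frac12\big(\sqrt{4(s^{(k)})^2+1}+1\big)$ and $\gamma^{(k)}=(s^{(k)}-1)/s^{(k+1)}$; $\overline{\mathbf x}^{(k)}$ is $\mathbf x^{(k)}+\gamma^{(k)}(\mathbf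 x^{(k)}-\mathbf x^{(k-1)})$ with each $3\times3$ block replaced by a nearest rotation in Frobenius norm. 2. $F^{\alpha(k)}=E^{\alpha(k)}+\Delta E^\alpha(\mathbf x^{(k)}|\mathbf x^{(k-1)})$ and $\overline F^{\alpha(k)}=(1-\eta)\overline F^{\alpha(k-1)}+\eta F^{\alpha(k)}$. 3. Each device $\alpha$ takes as $\mathbf x^{\alpha(k+1)}$ a local minimum of $E^\alpha(\cdot|\overline{\mathbf x}^{(k)})$ over the manifold, and sets $E^{\alpha(k+1)}=E^\alpha(\mathbf x^{\alpha(k+1)}|\mathbf x^{(k)})+F^{\alpha(k)}-E^\alpha(\mathbf x^{\alpha(k)}|\mathbf x^{(k)})$. 4. If $E^{\alpha(k+1)}>\overline F^{\alpha(k)}$, device $\alpha$ instead takes as $\mathbf x^{\alpha(k+1)}$ a local minimum of $E^\alpha(\cdot|\mathbf x^{(k)})$ over the manifold with $E^\alpha(\mathbf x^{\alpha(k+1)}|\mathbf x^{(k)})\le E^\alpha(\mathbf x^{\alpha(k)}|\mathbf x^{(k)})$, and recomputes $E^{\alpha(k+1)}$ by the same formula. **Proposition.** Suppose that - $\rho:[0,\infty)\to\mathbb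 R$ is nonnegative, differentiable and concave with $\rho(0)=0$, $0\le\rho'\le1$, $\rho'(0)=1$ and Lipschitz continuous $\rho'$; - there is $\epsilon>0$ with $\|\mathbf l_j^{(k)}-\mathbf t_i^{(k)}\|>\epsilon$ for all $k\ge0$ and $(i,j)\in\mathcal E$; - the intrinsics $\mathbf d_i^{(k)}$ are bounded uniformly in $k$ and $i$. Then the iterates of DABA converge to first-order critical points: $F$ is differentiable at every $\mathbf x^{(k)}$, and $\operatorname{grad}F(\mathbf x^{(k)})\to\mathbf 0$ as $k\to\infty$, where $\operatorname{grad}$ is the Riemannian gradient on $(SO(3)\times\mathbb R^3\times\mathbb R^3)^M\times(\mathbb R^3)^N$ as a submanifold of Euclidean space: it is the Euclidean gradient, except that a rotation component $\mathbf G$ of the latter at $\mathbf R_i$ becomes $\frac12\mathbf G-\frac12\mathbf R_i\mathbf G^\top\mathbf R_i$. -/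

import Mathlib

open Filter Topology
open scoped Matrix

namespace DABA

noncomputable section

/-- Scalar coordinates of the unknowns: every camera has the 9 entries of its rotation matrix,
the 3 entries of its translation and the 3 entries of its intrinsics; every point has 3 entries. -/
abbrev Coord (M N : ℕ) : Type :=
  (Fin M × ((Fin 3 × Fin 3) ⊕ (Fin 3 ⊕ Fin 3))) ⊕ (Fin N × Fin 3)

/-- The ambient Euclidean space of all unknowns. -/
abbrev State (M N : ℕ) : Type := EuclideanSpace ℝ (Coord M N)

section Accessors

variable {M N : ℕ}

/-- The rotation block `R_i`. -/
def rot (x : State M N) (i : Fin M) : Matrix (Fin 3) (Fin 3) ℝ :=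
  Matrix.of fun a b => x (Sum.inl (i, Sum.inl (a, b)))

/-- The translation block `t_i`. -/
def trans (x : State M N) (i : Fin M) : Fin 3 → ℝ :=
  fun a => x (Sum.inl (i, Sum.inr (Sum.inl a)))

/-- The intrinsics block `d_i`. -/
def intr (x : State M N) (i : Fin M) : Fin 3 → ℝ :=
  fun a => x (Sum.inl (i, Sum.inr (Sum.inr a)))

/-- The position `l_j` of a point. -/
def pt (x : State M N) (j : Fin N) : Fin 3 → ℝ :=
  fun a => x (Sum.inr (j, a))

end Accessors

/-- The squared Euclidean norm of a vector of `ℝ³`. -/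
def sqNorm (v : Fin 3 → ℝ) : ℝ := ∑ a, v a ^ 2

/-- The Euclidean norm of a vector of `ℝ³`. -/
def eucNorm (v : Fin 3 → ℝ) : ℝ := ‖(WithLp.toLp 2 v : EuclideanSpace ℝ (Fin 3))‖

/-- The squared Frobenius norm of a `3 × 3` matrix. -/
def frobSq (A : Matrix (Fin 3) (Fin 3) ℝ) : ℝ := ∑ a, ∑ b, A a b ^ 2

/-- The rotation group `SO(3)`. -/
def SO3 : Set (Matrix (Fin 3) (Fin 3) ℝ) :=
  {R | R ∈ Matrix.specialOrthogonalGroup (Fin 3) ℝ}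

/-- `(SE(3) × ℝ³)^M × (ℝ³)^N` inside the ambient Euclidean space. -/
def feasible (M N : ℕ) : Set (State M N) := {x | ∀ i, rot x i ∈ SO3}

/-- The data of a bundle adjustment problem with `M` cameras and `N` points that are distributed
over `S` devices. -/
structure Problem (M N S : ℕ) where
  /-- the set of reprojection pairs (camera, point) -/
  edges : Finset (Fin M × Fin N)
  /-- the observed image points -/
  obs : Fin M → Fin N → EuclideanSpace ℝ (Fin 2)
  /-- the device that holds a camera -/
  camDev : Fin M → Fin S
  /-- the device that holds a point -/
  ptDev : Fin N → Fin S
  /-- the robust loss; only its values on `[0, ∞)` are ever used -/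
  loss : ℝ → ℝ

/-- The derivative of a function on `[0, ∞)`, one-sided at `0`. -/
def dloss (ρ : ℝ → ℝ) (s : ℝ) : ℝ := derivWithin ρ (Set.Ici 0) s

/-- The standing conditions on a robust loss `ρ : [0, ∞) → ℝ`. -/
structure IsRobustLoss (ρ : ℝ → ℝ) : Prop where
  nonneg : ∀ s, 0 ≤ s → 0 ≤ ρ s
  map_zero : ρ 0 = 0
  differentiable : DifferentiableOn ℝ ρ (Set.Ici 0)
  concave : ConcaveOn ℝ (Set.Ici 0) ρ
  deriv_mem : ∀ s, 0 ≤ s → 0 ≤ dloss ρ s ∧ dloss ρ s ≤ 1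
  deriv_zero : dloss ρ 0 = 1
  lipschitz : ∃ L : NNReal, LipschitzOnWith L (dloss ρ) (Set.Ici 0)

section Problem

variable {M N S : ℕ} (P : Problem M N S)

/-- The undistorted ray `p_ij`, a function of the intrinsics `d_i`. -/
def ray (x : State M N) (i : Fin M) (j : Fin N) : Fin 3 → ℝ :=
  ![P.obs i j 0, P.obs i j 1,
    intr x i 0 + intr x i 1 * ‖P.obs i j‖ ^ 2 + intr x i 2 * ‖P.obs i j‖ ^ 4]

/-- The reprojection error
`e_ij = (I - R_iᵀ (l_j - t_i) (l_j - t_i)ᵀ R_i / ‖l_j - t_i‖²) p_ij`. -/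
def err (x : State M N) (i : Fin M) (j : Fin N) : Fin 3 → ℝ :=
  (1 - (1 / sqNorm (pt x j - trans x i)) •
      ((rot x i)ᵀ * Matrix.vecMulVec (pt x j - trans x i) (pt x j - trans x i) * rot x i))
    *ᵥ ray P x i j

/-- The penalty `F_ij = ρ(‖e_ij‖²) / 2` of a reprojection pair. -/
def pairCost (x : State M N) (i : Fin M) (j : Fin N) : ℝ :=
  1 / 2 * P.loss (sqNorm (err P x i j))

/-- The objective `F`. -/
def objective (x : State M N) : ℝ := ∑ e ∈ P.edges, pairCost P x e.1 e.2

/-- The weight `w_ij` at the base point `y`. -/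
def weight (y : State M N) (i : Fin M) (j : Fin N) : ℝ :=
  dloss P.loss (sqNorm (err P y i j))

/-- The constant `a_ij` at the base point `y`. -/
def offset (y : State M N) (i : Fin M) (j : Fin N) : ℝ :=
  1 / 2 * P.loss (sqNorm (err P y i j))
    - 1 / 2 * dloss P.loss (sqNorm (err P y i j)) * sqNorm (err P y i j)

/-- The scale `λ_ij = (l_j - t_i)ᵀ R_i p_ij / ‖l_j - t_i‖²` at the base point `y`. -/
def scale (y : State M N) (i : Fin M) (j : Fin N) : ℝ :=
  (pt y j - trans y i) ⬝ᵥ (rot y i *ᵥ ray P y i j) / sqNorm (pt y j - trans y i)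

/-- The midpoint `g_ij` at the base point `y`. -/
def mid (y : State M N) (i : Fin M) (j : Fin N) : Fin 3 → ℝ :=
  (1 / 2 : ℝ) • (rot y i *ᵥ ray P y i j) + (1 / 2 * scale P y i j) • trans y i
    + (1 / 2 * scale P y i j) • pt y j

/-- The camera part `P_ij(c_i | y)` of the surrogate of a pair. -/
def camSurrogate (x y : State M N) (i : Fin M) (j : Fin N) : ℝ :=
  weight P y i j *
      sqNorm (rot x i *ᵥ ray P x i j + scale P y i j • trans x i - mid P y i j)
    + 1 / 2 * offset P y i j

/-- The point part `Q_ij(l_j | y)` of the surrogate of a pair. -/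
def ptSurrogate (x y : State M N) (i : Fin M) (j : Fin N) : ℝ :=
  weight P y i j * sqNorm (scale P y i j • pt x j - mid P y i j) + 1 / 2 * offset P y i j

/-- The device that holds a coordinate of the unknowns. -/
def device : Coord M N → Fin S
  | Sum.inl (i, _) => P.camDev i
  | Sum.inr (j, _) => P.ptDev j

/-- `x^α = y^α`: the unknowns held by device `α` agree. -/
def SameBlock (α : Fin S) (x y : State M N) : Prop := ∀ v, device P v = α → x v = y v

/-- `‖x^α - y^α‖²`. -/
def blockDistSq (α : Fin S) (x y : State M N) : ℝ :=
  ∑ v with device P v = α, (x v - y v) ^ 2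

/-- The surrogate `E^α(x^α | y)` of device `α`. It is written as a function of all unknowns `x`,
of which it uses only the block `x^α`. -/
def surrogate (ξ : ℝ) (α : Fin S) (x y : State M N) : ℝ :=
  1 / 2 * ξ * blockDistSq P α x y
    + ∑ e ∈ P.edges with P.camDev e.1 = α ∧ P.ptDev e.2 = α, pairCost P x e.1 e.2
    + ∑ e ∈ P.edges with P.camDev e.1 = α ∧ P.ptDev e.2 ≠ α, camSurrogate P x y e.1 e.2
    + ∑ e ∈ P.edges with P.camDev e.1 ≠ α ∧ P.ptDev e.2 = α, ptSurrogate P x y e.1 e.2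

theorem surrogate_congr (ξ : ℝ) (α : Fin S) {x x' : State M N} (y : State M N)
    (h : SameBlock P α x x') : surrogate P ξ α x y = surrogate P ξ α x' y := by
  have hr : ∀ i, P.camDev i = α → rot x i = rot x' i := fun i hi => by
    ext a b; exact h _ hi
  have ht : ∀ i, P.camDev i = α → trans x i = trans x' i := fun i hi => by
    ext a; exact h _ hi
  have hd : ∀ i, P.camDev i = α → intr x i = intr x' i := fun i hi => by
    ext a; exact h _ hi
  have hp : ∀ j, P.ptDev j = α → pt x j = pt x' j := fun j hj => by
    ext a; exact h _ hj
  unfold surrogate blockDistSq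
  congr 1
  · congr 1
    · congr 1
      · congr 1
        refine Finset.sum_congr rfl fun v hv => ?_
        rw [h v (Finset.mem_filter.1 hv).2]
      · refine Finset.sum_congr rfl fun e he => ?_
        obtain ⟨-, h1, h2⟩ := Finset.mem_filter.1 he
        simp only [pairCost, err, ray, hr _ h1, ht _ h1, hd _ h1, hp _ h2]
    · refine Finset.sum_congr rfl fun e he => ?_
      obtain ⟨-, h1, -⟩ := Finset.mem_filter.1 he
      simp only [camSurrogate, ray, hr _ h1, ht _ h1, hd _ h1]
  · refine Finset.sum_congr rfl fun e he => ?_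
    obtain ⟨-, -, h2⟩ := Finset.mem_filter.1 he
    simp only [ptSurrogate, hp _ h2]

/-- The surrogate gap `ΔE^α(x | y)`. The sum is over the pairs of which exactly one member is
held by device `α`. -/
def gap (ξ : ℝ) (α : Fin S) (x y : State M N) : ℝ :=
  -(1 / 2 * ξ * blockDistSq P α x y)
    + 1 / 2 * ∑ e ∈ P.edges with
          (P.camDev e.1 = α ∧ P.ptDev e.2 ≠ α) ∨ (P.camDev e.1 ≠ α ∧ P.ptDev e.2 = α),
        (pairCost P x e.1 e.2 - camSurrogate P x y e.1 e.2 - ptSurrogate P x y e.1 e.2)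

/-- The block `z^α` is a local minimum of `E^α(· | y)` on the manifold. As `E^α(· | y)` depends
on the block of device `α` only, it does not matter that the other blocks may vary too. -/
def IsLocalSolution (ξ : ℝ) (α : Fin S) (y z : State M N) : Prop :=
  z ∈ feasible M N ∧ IsLocalMinOn (fun z' => surrogate P ξ α z' y) (feasible M N) z

/-! In the sequences below, index `k` stands for the `k`-th iterate, and the iterate of index `-1`
is by convention the initial one, so that `x (k - 1)`, with truncated subtraction, is the
predecessor of `x k` for all `k ≥ 0`. -/

/-- The metric `E^{α(k)}`; the bracket in the recursion is `F^{α(k)}`. -/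
def metricE (ξ : ℝ) (x : ℕ → State M N) (α : Fin S) : ℕ → ℝ
  | 0 => surrogate P ξ α (x 0) (x 0)
  | k + 1 => surrogate P ξ α (x (k + 1)) (x k)
      + (metricE ξ x α k + gap P ξ α (x k) (x (k - 1))) - surrogate P ξ α (x k) (x k)

/-- The metric `F^{α(k)}`, `k ≥ 0`. -/
def metricF (ξ : ℝ) (x : ℕ → State M N) (α : Fin S) (k : ℕ) : ℝ :=
  metricE P ξ x α k + gap P ξ α (x k) (x (k - 1))

/-- The exponential average of the metrics `F^{α(k)}`, `k ≥ 0`; its value at `k = -1` is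
`E^α(x⁰ | x⁰)`. -/
def metricFbar (ξ η : ℝ) (x : ℕ → State M N) (α : Fin S) : ℕ → ℝ
  | 0 => (1 - η) * surrogate P ξ α (x 0) (x 0) + η * metricF P ξ x α 0
  | k + 1 => (1 - η) * metricFbar ξ η x α k + η * metricF P ξ x α (k + 1)

/-- The value that `E^{α(k+1)}` takes if `z^α` is chosen as the next block of device `α`. -/
def trialE (ξ : ℝ) (x : ℕ → State M N) (α : Fin S) (k : ℕ) (z : State M N) : ℝ :=
  surrogate P ξ α z (x k) + metricF P ξ x α k - surrogate P ξ α (x k) (x k)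

/-- Nesterov's scalars `s^{(k)}`; they are the same on all devices. -/
def nesterovS : ℕ → ℝ
  | 0 => 1
  | k + 1 => (Real.sqrt (4 * nesterovS k ^ 2 + 1) + 1) / 2

/-- The extrapolation ratio `γ^{(k)}`. -/
def nesterovGamma (k : ℕ) : ℝ := (nesterovS k - 1) / nesterovS (k + 1)

/-- `R` is a projection of `A` to `SO(3)`, that is, a nearest rotation. -/
def IsProjRot (A R : Matrix (Fin 3) (Fin 3) ℝ) : Prop :=
  R ∈ SO3 ∧ ∀ R' ∈ SO3, frobSq (R - A) ≤ frobSq (R' - A)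

/-- `z` is the extrapolation of `y` with momentum `y - y'` and ratio `γ`, projected to the
manifold. -/
structure IsExtrapolation (γ : ℝ) (y' y z : State M N) : Prop where
  rot_eq : ∀ i, IsProjRot (rot y i + γ • (rot y i - rot y' i)) (rot z i)
  trans_eq : ∀ i, trans z i = trans y i + γ • (trans y i - trans y' i)
  intr_eq : ∀ i, intr z i = intr y i + γ • (intr y i - intr y' i)
  pt_eq : ∀ j, pt z j = pt y j + γ • (pt y j - pt y' j)

/-- `x` is a sequence of iterates of the method, `xbar` the sequence of extrapolated points and
`cand k` collects the blocks that the devices find in the accelerated update of step `k`, before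
the restart test. -/
structure IsRun (ξ η : ℝ) (x xbar cand : ℕ → State M N) : Prop where
  init : x 0 ∈ feasible M N
  extrapolate : ∀ k, IsExtrapolation (nesterovGamma k) (x (k - 1)) (x k) (xbar k)
  /-- the accelerated update -/
  solve : ∀ k α, IsLocalSolution P ξ α (xbar k) (cand k)
  /-- no restart: the block found is kept -/
  keep : ∀ k α, trialE P ξ x α k (cand k) ≤ metricFbar P ξ η x α k →
    SameBlock P α (x (k + 1)) (cand k)
  /-- restart: the block is replaced by a local minimum of `E^α(· | xᵏ)` that is not worse than
  the current block -/
  restart : ∀ k α, metricFbar P ξ η x α k < trialE P ξ x α k (cand k) →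
    IsLocalSolution P ξ α (x k) (x (k + 1)) ∧
      surrogate P ξ α (x (k + 1)) (x k) ≤ surrogate P ξ α (x k) (x k)

end Problem

/-- The Riemannian gradient at a point `x` of the manifold of a function on the ambient space: the
orthogonal projection of the Euclidean gradient `G` to the tangent space, which is
`(G_R - R G_Rᵀ R) / 2` in a rotation block and the identity in all other blocks. -/
def riemGrad {M N : ℕ} (f : State M N → ℝ) (x : State M N) : State M N :=
  WithLp.toLp 2 fun v =>
    match v with
    | Sum.inl (i, Sum.inl (a, b)) =>
        ((1 / 2 : ℝ) • rot (gradient f x) i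
          - (1 / 2 : ℝ) • (rot x i * (rot (gradient f x) i)ᵀ * rot x i)) a b
    | Sum.inl (i, Sum.inr c) => gradient f x (Sum.inl (i, Sum.inr c))
    | Sum.inr w => gradient f x (Sum.inr w)

end

end DABA

namespace DABA

/-! ### Algebra of the reprojection error -/

/-! This is majorization-minimization with a safeguard. A concave `ρ` lies below its tangents. The
error is the least-squares residual of `R_i p_ij` against multiples of `l_j - t_i`, so freezing the
multiple at `λ_ij` can only enlarge it. The parallelogram law around `g_ij` then splits the bound
into a camera part and a point part. Hence `F_ij ≤ P_ij + Q_ij` on the manifold, with equality at a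
feasible base point (`pairCost_le_surrogates`, `surrogates_self`).

Over all devices the quantities `E^α + ΔE^α` add up to `F`, so the local metrics `F^α` sum to the
objective (`sum_metricF`) although no device knows it. The restart test keeps `E^α` of the next step
below the running average, and the gap pays the proximal term. The sum of the averages therefore
drops by at least `ξη/2 ‖x (k+1) - x k‖²` per step while staying above `F ≥ 0`. So the steps vanish,
and the extrapolated points approach the iterates (`IsRun.tendsto_step`, `IsExtrapolation.tendsto`).

Each block of `x (k+1)` is thus a local minimum of `E^α(· | y)` for a base `y` close to `x (k+1)`.
Since `F` and `∑ E^α(· | x (k+1))` touch at `x (k+1)`, block `α` of `grad F` is a projected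
difference of two gradients of `E^α`, with bases `x (k+1)` and `y` (`riemGrad_objective_apply`). It
remains to bound this difference without compactness, as translations and points may be unbounded.
They enter it only through bearings, depths and inverse distances, all bounded, and through
vanishing differences; `Merging` is the calculus of such sequences. -/

theorem sqNorm_eq_dotProduct (v : Fin 3 → ℝ) : sqNorm v = v ⬝ᵥ v := by
  simp [sqNorm, dotProduct, sq]

theorem sqNorm_nonneg (v : Fin 3 → ℝ) : 0 ≤ sqNorm v :=
  Finset.sum_nonneg fun _ _ => sq_nonneg _

theorem sqNorm_eq_zero {v : Fin 3 → ℝ} : sqNorm v = 0 ↔ v = 0 := by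
  rw [sqNorm_eq_dotProduct, dotProduct_self_eq_zero]

theorem sq_eucNorm (v : Fin 3 → ℝ) : eucNorm v ^ 2 = sqNorm v := by
  simp [eucNorm, sqNorm, EuclideanSpace.norm_sq_eq]

theorem eucNorm_nonneg (v : Fin 3 → ℝ) : 0 ≤ eucNorm v := norm_nonneg _

theorem abs_apply_le_eucNorm (v : Fin 3 → ℝ) (a : Fin 3) : |v a| ≤ eucNorm v :=
  PiLp.norm_apply_le (WithLp.toLp 2 v : EuclideanSpace ℝ (Fin 3)) a

theorem transpose_mul_of_mem_SO3 {R : Matrix (Fin 3) (Fin 3) ℝ} (hR : R ∈ SO3) : Rᵀ * R = 1 :=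
  (Matrix.mem_orthogonalGroup_iff' (Fin 3) ℝ).1 (Matrix.mem_specialOrthogonalGroup_iff.1 hR).1

theorem mul_transpose_of_mem_SO3 {R : Matrix (Fin 3) (Fin 3) ℝ} (hR : R ∈ SO3) : R * Rᵀ = 1 :=
  (Matrix.mem_orthogonalGroup_iff (Fin 3) ℝ).1 (Matrix.mem_specialOrthogonalGroup_iff.1 hR).1

theorem abs_apply_le_one_of_mem_SO3 {R : Matrix (Fin 3) (Fin 3) ℝ} (hR : R ∈ SO3)
    (a b : Fin 3) : |R a b| ≤ 1 := by
  have h := congrFun (congrFun (mul_transpose_of_mem_SO3 hR) a) a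
  simp only [Matrix.mul_apply, Matrix.transpose_apply, Matrix.one_apply_eq] at h
  have h1 : R a b * R a b ≤ ∑ c, R a c * R a c :=
    Finset.single_le_sum (f := fun c => R a c * R a c) (fun c _ => mul_self_nonneg _)
      (Finset.mem_univ b)
  rw [abs_le_one_iff_mul_self_le_one]
  linarith

theorem sqNorm_mulVec_of_mem_SO3 {R : Matrix (Fin 3) (Fin 3) ℝ} (hR : R ∈ SO3)
    (v : Fin 3 → ℝ) : sqNorm (R *ᵥ v) = sqNorm v := by
  rw [sqNorm_eq_dotProduct, sqNorm_eq_dotProduct, Matrix.dotProduct_mulVec,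
    Matrix.vecMul_mulVec, transpose_mul_of_mem_SO3 hR, Matrix.vecMul_one]

theorem sqNorm_transpose_mulVec_of_mem_SO3 {R : Matrix (Fin 3) (Fin 3) ℝ} (hR : R ∈ SO3)
    (v : Fin 3 → ℝ) : sqNorm (Rᵀ *ᵥ v) = sqNorm v := by
  rw [sqNorm_eq_dotProduct, sqNorm_eq_dotProduct, Matrix.dotProduct_mulVec,
    Matrix.vecMul_mulVec, Matrix.transpose_transpose, mul_transpose_of_mem_SO3 hR,
    Matrix.vecMul_one]

theorem sqNorm_sub_smul (v w : Fin 3 → ℝ) (c : ℝ) :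
    sqNorm (v - c • w) = sqNorm v - 2 * c * (w ⬝ᵥ v) + c ^ 2 * sqNorm w := by
  simp only [sqNorm, dotProduct, Fin.sum_univ_three, Pi.sub_apply, Pi.smul_apply, smul_eq_mul]
  ring

variable {M N S : ℕ} (P : Problem M N S)

theorem err_eq (x : State M N) (i : Fin M) (j : Fin N) :
    err P x i j = ray P x i j - scale P x i j • ((rot x i)ᵀ *ᵥ (pt x j - trans x i)) := by
  rw [err, Matrix.sub_mulVec, Matrix.one_mulVec, Matrix.smul_mulVec, ← Matrix.mulVec_mulVec,
    ← Matrix.mulVec_mulVec, Matrix.vecMulVec_mulVec, scale]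
  congr 1
  rw [op_smul_eq_smul, Matrix.mulVec_smul, smul_smul]
  congr 1
  ring

/-- The point `R_i p_ij`. -/
noncomputable abbrev rotRay (x : State M N) (i : Fin M) (j : Fin N) : Fin 3 → ℝ := rot x i *ᵥ ray P x i j

/-- Multiplying `e` by the isometry `R` turns it into `R p - λ (l - t)`. -/
theorem sqNorm_err {x : State M N} (hx : x ∈ feasible M N) (i : Fin M) (j : Fin N) :
    sqNorm (err P x i j) =
      sqNorm (rotRay P x i j - scale P x i j • (pt x j - trans x i)) := by
  rw [err_eq, sqNorm_sub_smul, sqNorm_sub_smul, sqNorm_mulVec_of_mem_SO3 (hx i),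
    sqNorm_transpose_mulVec_of_mem_SO3 (hx i), Matrix.dotProduct_mulVec,
    Matrix.mulVec_transpose]

/-- The scale `λ` minimizes the quadratic `c ↦ ‖R p - c (l - t)‖²`; the excess at `c` is a completed
square. -/
theorem sqNorm_err_le {x : State M N} (hx : x ∈ feasible M N) (i : Fin M) (j : Fin N) (c : ℝ) :
    sqNorm (err P x i j) ≤ sqNorm (rotRay P x i j - c • (pt x j - trans x i)) := by
  rw [sqNorm_err P hx, sqNorm_sub_smul, sqNorm_sub_smul, scale]
  rcases (sqNorm_nonneg (pt x j - trans x i)).eq_or_lt with h | h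
  -- If `l = t`, the multiple `c` is irrelevant and both sides are `‖R p‖²`.
  · rw [sqNorm_eq_zero.1 h.symm]
    simp [sqNorm]
  · generalize (pt x j - trans x i) ⬝ᵥ rotRay P x i j = d at *
    generalize sqNorm (pt x j - trans x i) = s at *
    have : (sqNorm (rotRay P x i j) - 2 * c * d + c ^ 2 * s)
        - (sqNorm (rotRay P x i j) - 2 * (d / s) * d + (d / s) ^ 2 * s)
        = (c * s - d) ^ 2 / s := by field_simp; ring
    have h2 : 0 ≤ (c * s - d) ^ 2 / s := by positivity
    linarith

/-! ### Majorization -/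

theorem IsRobustLoss.le_tangent {ρ : ℝ → ℝ} (h : IsRobustLoss ρ) {s t : ℝ} (hs : 0 ≤ s)
    (ht : 0 ≤ t) : ρ t ≤ ρ s + dloss ρ s * (t - s) := by
  rcases lt_trichotomy s t with hst | rfl | hst
  · have := h.concave.slope_le_derivWithin hs ht hst (h.differentiable s hs)
    rw [slope_def_field, div_le_iff₀ (by linarith)] at this
    unfold dloss; linarith
  · simp
  · have := h.concave.derivWithin_le_slope ht hs hst (h.differentiable s hs)
    rw [slope_def_field, le_div_iff₀ (by linarith)] at this
    unfold dloss; linarith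

/-- By the parallelogram law the defect is the squared norm of `(v - g) + (w - g)`, which vanishes
when `g` is the midpoint. -/
theorem sqNorm_sub_le (v w g : Fin 3 → ℝ) :
    sqNorm (v - w) ≤ 2 * (sqNorm (v - g) + sqNorm (w - g)) := by
  simp only [sqNorm, Fin.sum_univ_three, Pi.sub_apply]
  nlinarith [sq_nonneg (v 0 - g 0 + (w 0 - g 0)), sq_nonneg (v 1 - g 1 + (w 1 - g 1)),
    sq_nonneg (v 2 - g 2 + (w 2 - g 2))]

theorem pairCost_le_surrogates (hl : IsRobustLoss P.loss) {x : State M N}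
    (hx : x ∈ feasible M N) (y : State M N) (i : Fin M) (j : Fin N) :
    pairCost P x i j ≤ camSurrogate P x y i j + ptSurrogate P x y i j := by
  have h1 := hl.le_tangent (sqNorm_nonneg (err P y i j)) (sqNorm_nonneg (err P x i j))
  have h2 : sqNorm (err P x i j) ≤
      2 * (sqNorm (rot x i *ᵥ ray P x i j + scale P y i j • trans x i - mid P y i j)
        + sqNorm (scale P y i j • pt x j - mid P y i j)) := by
    refine le_trans ?_ (sqNorm_sub_le _ _ _)
    have h := sqNorm_err_le P hx i j (scale P y i j)
    rwa [smul_sub, ← sub_add, sub_add_eq_add_sub] at h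
  have h3 := (hl.deriv_mem _ (sqNorm_nonneg (err P y i j))).1
  have h4 := mul_le_mul_of_nonneg_left h2 h3
  unfold pairCost camSurrogate ptSurrogate offset weight
  linarith

/-- At the base point `g` is the midpoint of `R p + λ t` and `λ l`, so the parallelogram bound is an
equality, and so is the tangent bound. -/
theorem surrogates_self {x : State M N} (hx : x ∈ feasible M N) (i : Fin M) (j : Fin N) :
    camSurrogate P x x i j + ptSurrogate P x x i j = pairCost P x i j := by
  have h1 : sqNorm (err P x i j) =
      2 * (sqNorm (rot x i *ᵥ ray P x i j + scale P x i j • trans x i - mid P x i j)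
        + sqNorm (scale P x i j • pt x j - mid P x i j)) := by
    rw [sqNorm_err P hx]
    simp only [mid, sqNorm, Fin.sum_univ_three, Pi.sub_apply, Pi.add_apply, Pi.smul_apply,
      smul_eq_mul]
    ring
  unfold pairCost camSurrogate ptSurrogate offset weight
  linear_combination (-(1 / 2) * dloss P.loss (sqNorm (err P x i j))) * h1

/-! ### Energy balance -/

theorem blockDistSq_nonneg (α : Fin S) (x y : State M N) : 0 ≤ blockDistSq P α x y :=
  Finset.sum_nonneg fun _ _ => sq_nonneg _

theorem blockDistSq_self (α : Fin S) (x : State M N) : blockDistSq P α x x = 0 := by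
  simp [blockDistSq]

theorem sum_blockDistSq (x y : State M N) : ∑ α, blockDistSq P α x y = ‖x - y‖ ^ 2 := by
  unfold blockDistSq
  rw [Finset.sum_fiberwise, EuclideanSpace.norm_sq_eq]
  simp

theorem gap_le (hl : IsRobustLoss P.loss) (ξ : ℝ) (α : Fin S) {x : State M N}
    (hx : x ∈ feasible M N) (y : State M N) :
    gap P ξ α x y ≤ -(1 / 2 * ξ * blockDistSq P α x y) := by
  unfold gap
  have : ∑ e ∈ P.edges with
      (P.camDev e.1 = α ∧ P.ptDev e.2 ≠ α) ∨ (P.camDev e.1 ≠ α ∧ P.ptDev e.2 = α),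
      (pairCost P x e.1 e.2 - camSurrogate P x y e.1 e.2 - ptSurrogate P x y e.1 e.2) ≤ 0 :=
    Finset.sum_nonpos fun e _ => by
      linarith [pairCost_le_surrogates P hl hx y e.1 e.2]
  linarith

theorem gap_self (ξ : ℝ) (α : Fin S) {x : State M N} (hx : x ∈ feasible M N) :
    gap P ξ α x x = 0 := by
  unfold gap
  rw [blockDistSq_self, Finset.sum_eq_zero]
  · simp
  · intro e _
    linarith [surrogates_self P hx e.1 e.2]

/-- A pair cut by the partition is seen by two devices: one contributes `P`, the other `Q`, and each
adds half of `F - P - Q`. The proximal terms cancel on every device. -/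
theorem sum_surrogate_add_gap (ξ : ℝ) (x y : State M N) :
    ∑ α, (surrogate P ξ α x y + gap P ξ α x y) = objective P x := by
  -- Each pair is charged once to its camera's device and once to its point's device, an uncut pair
  -- to the former only, so that the sum over `α` collapses.
  have h : ∀ α, surrogate P ξ α x y + gap P ξ α x y = ∑ e ∈ P.edges,
      ((if P.camDev e.1 = α then
          (if P.ptDev e.2 = P.camDev e.1 then pairCost P x e.1 e.2 else
            camSurrogate P x y e.1 e.2 + 1 / 2 * (pairCost P x e.1 e.2
              - camSurrogate P x y e.1 e.2 - ptSurrogate P x y e.1 e.2)) else 0)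
        + (if P.ptDev e.2 = α then
          (if P.ptDev e.2 = P.camDev e.1 then 0 else
            ptSurrogate P x y e.1 e.2 + 1 / 2 * (pairCost P x e.1 e.2
              - camSurrogate P x y e.1 e.2 - ptSurrogate P x y e.1 e.2)) else 0)) := by
    intro α
    unfold surrogate gap
    simp only [Finset.sum_filter]
    rw [Finset.mul_sum]
    rw [show ∀ a b c d e : ℝ, a + b + c + d + (-a + e) = b + c + d + e by intros; ring,
      ← Finset.sum_add_distrib, ← Finset.sum_add_distrib, ← Finset.sum_add_distrib]
    refine Finset.sum_congr rfl fun e _ => ?_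
    by_cases h1 : P.camDev e.1 = α <;> by_cases h2 : P.ptDev e.2 = α
    · simp [h1, h2]
    · simp [h1, h2]
    · simp [h1, h2, Ne.symm h1]
    · simp [h1, h2]
  simp only [h]
  rw [Finset.sum_comm, objective]
  refine Finset.sum_congr rfl fun e _ => ?_
  rw [Finset.sum_add_distrib, Finset.sum_ite_eq, Finset.sum_ite_eq]
  simp only [Finset.mem_univ, if_true]
  split_ifs
  · ring
  · ring

theorem sum_surrogate_self (ξ : ℝ) {x : State M N} (hx : x ∈ feasible M N) :
    ∑ α, surrogate P ξ α x x = objective P x := by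
  rw [← sum_surrogate_add_gap P ξ x x]
  simp [gap_self P ξ _ hx]

theorem objective_le_sum_surrogate (hl : IsRobustLoss P.loss) {ξ : ℝ} (hξ : 0 ≤ ξ)
    {x : State M N} (hx : x ∈ feasible M N) (y : State M N) :
    objective P x ≤ ∑ α, surrogate P ξ α x y := by
  rw [← sum_surrogate_add_gap P ξ x y]
  refine Finset.sum_le_sum fun α _ => ?_
  have h1 := gap_le P hl ξ α hx y
  have h2 := blockDistSq_nonneg P α x y
  have h3 : 0 ≤ 1 / 2 * ξ * blockDistSq P α x y := by positivity
  linarith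

theorem objective_nonneg (hl : IsRobustLoss P.loss) (x : State M N) : 0 ≤ objective P x :=
  Finset.sum_nonneg fun e _ => by
    have := hl.nonneg _ (sqNorm_nonneg (err P x e.1 e.2))
    unfold pairCost; linarith

/-- The local corrections `F^α - E^α(x k | x k)` need not vanish, but their sum over the devices
does, by induction. -/
theorem sum_metricF (ξ : ℝ) {x : ℕ → State M N} (hx : ∀ k, x k ∈ feasible M N) (k : ℕ) :
    ∑ α, metricF P ξ x α k = objective P (x k) := by
  induction k with
  | zero =>
    rw [← sum_surrogate_add_gap P ξ (x 0) (x 0)]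
    rfl
  | succ k ih =>
    rw [← sum_surrogate_add_gap P ξ (x (k + 1)) (x k)]
    have : ∀ α, metricF P ξ x α (k + 1) =
        (surrogate P ξ α (x (k + 1)) (x k) + gap P ξ α (x (k + 1)) (x k))
          + (metricF P ξ x α k - surrogate P ξ α (x k) (x k)) := fun α => by
      simp only [metricF, metricE, Nat.add_sub_cancel]; ring
    simp only [this]
    rw [Finset.sum_add_distrib, Finset.sum_sub_distrib, ih, sum_surrogate_self P ξ (hx k)]
    simp

/-! ### Descent along a run -/

section Run

variable {P} {ξ η : ℝ} {x xbar cand : ℕ → State M N}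

theorem IsRun.mem_feasible (h : IsRun P ξ η x xbar cand) (k : ℕ) : x k ∈ feasible M N := by
  cases k with
  | zero => exact h.init
  | succ k =>
    intro i
    rcases le_or_gt (trialE P ξ x (P.camDev i) k (cand k)) (metricFbar P ξ η x (P.camDev i) k)
      with hc | hc
    · have hs := h.keep k _ hc
      have : rot (x (k + 1)) i = rot (cand k) i := by
        ext a b; exact hs _ rfl
      rw [this]
      exact (h.solve k (P.camDev i)).1 i
    · exact (h.restart k _ hc).1.1 i

/-- A kept block satisfies this by the test. After a restart `E^α` is at most `F^α`, which the
hypothesis puts below the average. -/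
theorem IsRun.metricE_succ_le (h : IsRun P ξ η x xbar cand) {α : Fin S} {k : ℕ}
    (hF : metricF P ξ x α k ≤ metricFbar P ξ η x α k) :
    metricE P ξ x α (k + 1) ≤ metricFbar P ξ η x α k := by
  have hE : metricE P ξ x α (k + 1) = surrogate P ξ α (x (k + 1)) (x k) + metricF P ξ x α k
    - surrogate P ξ α (x k) (x k) := rfl
  rw [hE]
  rcases le_or_gt (trialE P ξ x α k (cand k)) (metricFbar P ξ η x α k) with hc | hc
  · rw [surrogate_congr P ξ α (x k) (h.keep k α hc)]
    exact hc
  · linarith [(h.restart k α hc).2]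

theorem IsRun.metricF_succ_le (h : IsRun P ξ η x xbar cand) (hl : IsRobustLoss P.loss)
    {α : Fin S} {k : ℕ} (hF : metricF P ξ x α k ≤ metricFbar P ξ η x α k) :
    metricF P ξ x α (k + 1) ≤
      metricFbar P ξ η x α k - 1 / 2 * ξ * blockDistSq P α (x (k + 1)) (x k) := by
  have h1 := h.metricE_succ_le hF
  have h2 := gap_le P hl ξ α (h.mem_feasible (k + 1)) (x k)
  simp only [metricF, Nat.add_sub_cancel]
  linarith

/-- The new average is a convex combination of the old one and the new `F^α`, and the latter is the
smaller of the two. At index `0` both sides equal the initial surrogate, since the gap vanishes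
there. -/
theorem IsRun.metricF_le_metricFbar (h : IsRun P ξ η x xbar cand) (hl : IsRobustLoss P.loss)
    (hξ : 0 ≤ ξ) (hη : η ≤ 1) (α : Fin S) (k : ℕ) :
    metricF P ξ x α k ≤ metricFbar P ξ η x α k := by
  induction k with
  | zero =>
    have : metricF P ξ x α 0 = surrogate P ξ α (x 0) (x 0) := by
      simp [metricF, metricE, gap_self P ξ α h.init]
    simp only [metricFbar, this]
    linarith
  | succ k ih =>
    have h1 := h.metricF_succ_le hl ih
    have h2 : 0 ≤ 1 / 2 * ξ * blockDistSq P α (x (k + 1)) (x k) := by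
      have := blockDistSq_nonneg P α (x (k + 1)) (x k)
      positivity
    simp only [metricFbar]
    nlinarith

theorem tendsto_zero_of_le_sub {Φ b : ℕ → ℝ} (h0 : ∀ k, 0 ≤ Φ k) (hb : ∀ k, 0 ≤ b k)
    (h : ∀ k, Φ (k + 1) ≤ Φ k - b k) : Tendsto b atTop (𝓝 0) := by
  have hanti : Antitone Φ := antitone_nat_of_succ_le fun k => by linarith [h k, hb k]
  have hlim := tendsto_atTop_ciInf hanti ⟨0, by rintro _ ⟨k, rfl⟩; exact h0 k⟩
  have h1 := hlim.sub ((tendsto_add_atTop_iff_nat 1).2 hlim)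
  rw [sub_self] at h1
  exact squeeze_zero hb (fun k => by linarith [h k]) h1

theorem IsRun.tendsto_step (h : IsRun P ξ η x xbar cand) (hl : IsRobustLoss P.loss)
    (hξ : 0 < ξ) (hη0 : 0 < η) (hη1 : η ≤ 1) :
    Tendsto (fun k => x (k + 1) - x k) atTop (𝓝 0) := by
  have hF := h.metricF_le_metricFbar hl hξ.le hη1
  have key : Tendsto (fun k => 1 / 2 * (ξ * η) * ‖x (k + 1) - x k‖ ^ 2) atTop (𝓝 0) := by
    -- The potential is the sum of the averages; `F` itself need not decrease monotonically.
    refine tendsto_zero_of_le_sub (Φ := fun k => ∑ α, metricFbar P ξ η x α k) (fun k => ?_)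
      (fun k => by positivity) fun k => ?_
    · refine (objective_nonneg P hl (x k)).trans ?_
      rw [← sum_metricF P ξ h.mem_feasible k]
      exact Finset.sum_le_sum fun α _ => hF α k
    · rw [← sum_blockDistSq P, Finset.mul_sum, ← Finset.sum_sub_distrib]
      refine Finset.sum_le_sum fun α _ => ?_
      have h1 := mul_le_mul_of_nonneg_left (h.metricF_succ_le hl (hF α k)) hη0.le
      simp only [metricFbar]
      linarith
  have h2 : Tendsto (fun k => ‖x (k + 1) - x k‖ ^ 2) atTop (𝓝 0) := by
    have := key.const_mul (1 / 2 * (ξ * η))⁻¹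
    rw [mul_zero] at this
    refine this.congr fun k => ?_
    field_simp
  have h3 := h2.sqrt
  rw [Real.sqrt_zero] at h3
  refine tendsto_zero_iff_norm_tendsto_zero.2 (h3.congr fun k => ?_)
  rw [Real.sqrt_sq (norm_nonneg _)]

end Run

/-! ### First-order conditions on the manifold -/

/-- The orthogonal projection to the tangent space of the manifold at `x`. -/
noncomputable def tangentProj (x G : State M N) : State M N :=
  WithLp.toLp 2 fun v =>
    match v with
    | Sum.inl (i, Sum.inl (a, b)) =>
        ((1 / 2 : ℝ) • rot G i - (1 / 2 : ℝ) • (rot x i * (rot G i)ᵀ * rot x i)) a b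
    | Sum.inl (i, Sum.inr c) => G (Sum.inl (i, Sum.inr c))
    | Sum.inr w => G (Sum.inr w)

theorem riemGrad_eq_tangentProj (f : State M N → ℝ) (x : State M N) :
    riemGrad f x = tangentProj x (gradient f x) := rfl

/-- The standard basis vector of a coordinate. -/
noncomputable abbrev basisVec (v : Coord M N) : State M N := EuclideanSpace.single v 1

theorem gradient_apply (f : State M N → ℝ) (x : State M N) (v : Coord M N) :
    gradient f x v = fderiv ℝ f x (basisVec v) := by
  rw [← inner_gradient_left, EuclideanSpace.inner_single_right]
  simp

theorem tangentProj_sub (x G H : State M N) :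
    tangentProj x (G - H) = tangentProj x G - tangentProj x H := by
  have hr : ∀ i, rot (G - H) i = rot G i - rot H i := fun i => rfl
  ext v
  rcases v with ⟨i, ⟨a, b⟩ | c⟩ | w
  · simp only [tangentProj, hr, Matrix.transpose_sub, mul_sub, sub_mul, Matrix.sub_apply,
      Matrix.smul_apply, smul_eq_mul, PiLp.sub_apply]
    ring
  · simp [tangentProj]
  · simp [tangentProj]

theorem fderiv_eq_zero_of_curve {f : State M N → ℝ} {x x' : State M N}
    (hf : DifferentiableAt ℝ f x) (hmin : IsLocalMinOn f (feasible M N) x) {c : ℝ → State M N}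
    (hc : HasDerivAt c x' 0) (hc0 : c 0 = x) (hmem : ∀ θ, c θ ∈ feasible M N) :
    fderiv ℝ f x x' = 0 := by
  subst hc0
  have h1 : Tendsto c (𝓝 0) (𝓝[feasible M N] (c 0)) :=
    tendsto_nhdsWithin_iff.2 ⟨hc.continuousAt, Eventually.of_forall hmem⟩
  have h2 : IsLocalMin (f ∘ c) 0 := h1.eventually hmin
  exact h2.hasDerivAt_eq_zero (hf.hasFDerivAt.comp_hasDerivAt 0 hc)

/-- The rotation block of camera `i` moves to `R_i Γ(θ)`, the other blocks stay. -/
noncomputable def rotCurve (x : State M N) (i : Fin M) (Γ : ℝ → Matrix (Fin 3) (Fin 3) ℝ)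
    (θ : ℝ) : State M N :=
  WithLp.toLp 2 fun v =>
    match v with
    | Sum.inl (i', Sum.inl (a, b)) => if i' = i then (rot x i * Γ θ) a b else rot x i' a b
    | Sum.inl (i', Sum.inr c) => x (Sum.inl (i', Sum.inr c))
    | Sum.inr w => x (Sum.inr w)

/-- The tangent vector with rotation block `A` at camera `i` and no other component. -/
noncomputable def rotVec (i : Fin M) (A : Matrix (Fin 3) (Fin 3) ℝ) : State M N :=
  ∑ a, ∑ b, A a b • basisVec (Sum.inl (i, Sum.inl (a, b)))

theorem rotVec_apply_rot (i i' : Fin M) (A : Matrix (Fin 3) (Fin 3) ℝ) (a b : Fin 3) :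
    (rotVec i A : State M N) (Sum.inl (i', Sum.inl (a, b))) = if i' = i then A a b else 0 := by
  simp only [rotVec, WithLp.ofLp_sum, Finset.sum_apply, PiLp.smul_apply, PiLp.single_apply,
    smul_eq_mul, Sum.inl.injEq, Prod.mk.injEq]
  rw [Finset.sum_eq_single a, Finset.sum_eq_single b]
  · simp
  · intro b' _ hb
    simp [Ne.symm hb]
  · simp
  · intro a' _ ha
    simp [Ne.symm ha]
  · simp

theorem hasDerivAt_rotCurve (x : State M N) (i : Fin M) {Γ : ℝ → Matrix (Fin 3) (Fin 3) ℝ}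
    {K : Matrix (Fin 3) (Fin 3) ℝ} (hΓ : ∀ a b, HasDerivAt (fun θ => Γ θ a b) (K a b) 0) :
    HasDerivAt (rotCurve x i Γ) (rotVec i (rot x i * K)) 0 := by
  have h : ∀ v, HasDerivAt (fun θ => rotCurve x i Γ θ v)
      ((rotVec i (rot x i * K) : State M N) v) 0 := by
    rintro (⟨i', ⟨a, b⟩ | c⟩ | w)
    · rw [rotVec_apply_rot]
      by_cases hi : i' = i
      · simp only [rotCurve, hi, if_true, Matrix.mul_apply]
        exact HasDerivAt.fun_sum fun d _ => (hΓ d b).const_mul _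
      · simp only [rotCurve, hi, if_false]
        exact hasDerivAt_const _ _
    · have h0 : (rotVec i (rot x i * K) : State M N) (Sum.inl (i', Sum.inr c)) = 0 := by
        simp [rotVec]
      rw [h0]
      exact hasDerivAt_const _ _
    · have h0 : (rotVec i (rot x i * K) : State M N) (Sum.inr w) = 0 := by
        simp [rotVec]
      rw [h0]
      exact hasDerivAt_const _ _
  rw [hasDerivAt_iff_hasFDerivAt, ← hasFDerivWithinAt_univ, hasFDerivWithinAt_euclidean]
  intro v
  rw [hasFDerivWithinAt_univ]
  refine (h v).hasFDerivAt.congr_fderiv ?_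
  ext
  simp

theorem rotCurve_mem_feasible {x : State M N} (hx : x ∈ feasible M N) (i : Fin M)
    {Γ : ℝ → Matrix (Fin 3) (Fin 3) ℝ} (hΓ : ∀ θ, Γ θ ∈ SO3) (θ : ℝ) :
    rotCurve x i Γ θ ∈ feasible M N := by
  intro i'
  by_cases h : i' = i
  · have : rot (rotCurve x i Γ θ) i' = rot x i * Γ θ := by
      ext a b; simp [rot, rotCurve, h]
    rw [this]
    exact (Matrix.specialOrthogonalGroup (Fin 3) ℝ).mul_mem (hx i) (hΓ θ)
  · have : rot (rotCurve x i Γ θ) i' = rot x i' := by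
      ext a b; simp [rot, rotCurve, h]
    rw [this]
    exact hx i'

theorem rotCurve_zero (x : State M N) (i : Fin M) {Γ : ℝ → Matrix (Fin 3) (Fin 3) ℝ}
    (hΓ : Γ 0 = 1) : rotCurve x i Γ 0 = x := by
  ext v
  rcases v with ⟨i', ⟨a, b⟩ | c⟩ | w
  · by_cases h : i' = i
    · simp [rotCurve, h, hΓ, rot]
    · simp [rotCurve, h, rot]
  · rfl
  · rfl

/-- The derivative of a differentiable function vanishes at a local minimum on the manifold in the
direction of every curve through it. -/
theorem sum_gradient_mul_eq_zero {f : State M N → ℝ} {x : State M N}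
    (hx : x ∈ feasible M N) (hf : DifferentiableAt ℝ f x)
    (hmin : IsLocalMinOn f (feasible M N) x) (i : Fin M) {Γ : ℝ → Matrix (Fin 3) (Fin 3) ℝ}
    {K : Matrix (Fin 3) (Fin 3) ℝ} (hΓ : ∀ θ, Γ θ ∈ SO3) (hΓ0 : Γ 0 = 1)
    (hΓ' : ∀ a b, HasDerivAt (fun θ => Γ θ a b) (K a b) 0) :
    ∑ a, ∑ b, (rot x i * K) a b * rot (gradient f x) i a b = 0 := by
  have h := fderiv_eq_zero_of_curve hf hmin (hasDerivAt_rotCurve x i hΓ')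
    (rotCurve_zero x i hΓ0) (rotCurve_mem_feasible hx i hΓ)
  rw [rotVec, map_sum] at h
  rw [← h]
  refine Finset.sum_congr rfl fun a _ => ?_
  rw [map_sum]
  refine Finset.sum_congr rfl fun b _ => ?_
  rw [map_smul, ← gradient_apply, smul_eq_mul]
  rfl

theorem mem_SO3_of {A : Matrix (Fin 3) (Fin 3) ℝ} (h : A * Aᵀ = 1) (hd : A.det = 1) :
    A ∈ SO3 :=
  Matrix.mem_specialOrthogonalGroup_iff.2 ⟨(Matrix.mem_orthogonalGroup_iff (Fin 3) ℝ).2 h, hd⟩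

/-- The curves `R Γ(θ)`, with `Γ` a rotation about a coordinate axis, give `tr(Kᵀ Rᵀ G) = 0` for
three matrices `K` that span the skew-symmetric ones. Hence `Rᵀ G` is symmetric. -/
theorem rot_gradient_symm {f : State M N → ℝ} {x : State M N}
    (hx : x ∈ feasible M N) (hf : DifferentiableAt ℝ f x)
    (hmin : IsLocalMinOn f (feasible M N) x) (i : Fin M) :
    (rot x i)ᵀ * rot (gradient f x) i = (rot (gradient f x) i)ᵀ * rot x i := by
  have hs := fun θ : ℝ => Real.sin_sq_add_cos_sq θ
  have h0 := sum_gradient_mul_eq_zero hx hf hmin i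
    (Γ := fun θ => !![1, 0, 0; 0, Real.cos θ, -Real.sin θ; 0, Real.sin θ, Real.cos θ])
    (K := !![0, 0, 0; 0, 0, -1; 0, 1, 0])
    (fun θ => by
      refine mem_SO3_of ?_ ?_
      · ext a b
        fin_cases a <;> fin_cases b <;> simp [Matrix.mul_apply, Fin.sum_univ_three] <;>
          linarith [hs θ]
      · simp [Matrix.det_fin_three]; linarith [hs θ])
    (by ext a b; fin_cases a <;> fin_cases b <;> simp)
    (fun a b => by
      have h1 := Real.hasDerivAt_sin 0
      have h2 := Real.hasDerivAt_cos 0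
      have h3 := h1.neg
      rw [Real.cos_zero] at h1 h3
      rw [Real.sin_zero, neg_zero] at h2
      fin_cases a <;> fin_cases b <;>
        first | exact hasDerivAt_const _ _ | exact h1 | exact h2 | exact h3)
  have h1 := sum_gradient_mul_eq_zero hx hf hmin i
    (Γ := fun θ => !![Real.cos θ, 0, -Real.sin θ; 0, 1, 0; Real.sin θ, 0, Real.cos θ])
    (K := !![0, 0, -1; 0, 0, 0; 1, 0, 0])
    (fun θ => by
      refine mem_SO3_of ?_ ?_
      · ext a b
        fin_cases a <;> fin_cases b <;> simp [Matrix.mul_apply, Fin.sum_univ_three] <;>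
          linarith [hs θ]
      · simp [Matrix.det_fin_three]; linarith [hs θ])
    (by ext a b; fin_cases a <;> fin_cases b <;> simp)
    (fun a b => by
      have h1 := Real.hasDerivAt_sin 0
      have h2 := Real.hasDerivAt_cos 0
      have h3 := h1.neg
      rw [Real.cos_zero] at h1 h3
      rw [Real.sin_zero, neg_zero] at h2
      fin_cases a <;> fin_cases b <;>
        first | exact hasDerivAt_const _ _ | exact h1 | exact h2 | exact h3)
  have h2 := sum_gradient_mul_eq_zero hx hf hmin i
    (Γ := fun θ => !![Real.cos θ, -Real.sin θ, 0; Real.sin θ, Real.cos θ, 0; 0, 0, 1])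
    (K := !![0, -1, 0; 1, 0, 0; 0, 0, 0])
    (fun θ => by
      refine mem_SO3_of ?_ ?_
      · ext a b
        fin_cases a <;> fin_cases b <;> simp [Matrix.mul_apply, Fin.sum_univ_three] <;>
          linarith [hs θ]
      · simp [Matrix.det_fin_three]; linarith [hs θ])
    (by ext a b; fin_cases a <;> fin_cases b <;> simp)
    (fun a b => by
      have h1 := Real.hasDerivAt_sin 0
      have h2 := Real.hasDerivAt_cos 0
      have h3 := h1.neg
      rw [Real.cos_zero] at h1 h3
      rw [Real.sin_zero, neg_zero] at h2
      fin_cases a <;> fin_cases b <;>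
        first | exact hasDerivAt_const _ _ | exact h1 | exact h2 | exact h3)
  simp [Matrix.mul_apply, Fin.sum_univ_three] at h0 h1 h2
  ext a b
  fin_cases a <;> fin_cases b <;> simp [Matrix.mul_apply, Fin.sum_univ_three] <;> linarith

/-- First-order necessary condition on the manifold. -/
theorem riemGrad_eq_zero {f : State M N → ℝ} {x : State M N}
    (hx : x ∈ feasible M N) (hf : DifferentiableAt ℝ f x)
    (hmin : IsLocalMinOn f (feasible M N) x) : riemGrad f x = 0 := by
  -- Outside the rotation blocks the manifold is linear, so coordinate lines are admissible curves.
  have hlin : ∀ v, (∀ i w, v ≠ Sum.inl (i, Sum.inl w)) → gradient f x v = 0 := by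
    intro v hv
    rw [gradient_apply]
    refine fderiv_eq_zero_of_curve hf hmin (c := fun θ => x + θ • basisVec v) ?_ (by simp) ?_
    · simpa using ((hasDerivAt_id (0 : ℝ)).smul_const (basisVec v)).const_add x
    · intro θ i
      have : rot (x + θ • basisVec v) i = rot x i := by
        ext a b
        simp [rot, (hv i (a, b)).symm]
      rw [this]
      exact hx i
  ext v
  rcases v with ⟨i, ⟨a, b⟩ | c⟩ | w
  · have h := rot_gradient_symm hx hf hmin i
    -- Symmetry of `Rᵀ G` says `R Gᵀ R = G`, so the two halves of the projection cancel.
    have h2 : rot x i * (rot (gradient f x) i)ᵀ * rot x i = rot (gradient f x) i := by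
      rw [mul_assoc, ← h, ← mul_assoc, mul_transpose_of_mem_SO3 (hx i), one_mul]
    simp [riemGrad, h2]
  · exact hlin _ (by simp)
  · exact hlin _ (by simp)

theorem riemGrad_sub {f g : State M N → ℝ} {x : State M N}
    (hf : DifferentiableAt ℝ f x) (hg : DifferentiableAt ℝ g x) :
    riemGrad (fun z => f z - g z) x = riemGrad f x - riemGrad g x := by
  rw [riemGrad_eq_tangentProj, riemGrad_eq_tangentProj, riemGrad_eq_tangentProj,
    ← tangentProj_sub]
  congr 1
  ext v
  rw [PiLp.sub_apply, gradient_apply, gradient_apply, gradient_apply, fderiv_fun_sub hf hg]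
  rfl

/-- A function and a majorant on the manifold have the same Riemannian gradient where they
touch. -/
theorem riemGrad_eq_of_touching {f g : State M N → ℝ} {x : State M N} (hx : x ∈ feasible M N)
    (hf : DifferentiableAt ℝ f x) (hg : DifferentiableAt ℝ g x)
    (hle : ∀ z ∈ feasible M N, f z ≤ g z) (heq : f x = g x) : riemGrad f x = riemGrad g x := by
  have h := riemGrad_eq_zero (f := fun z => g z - f z) hx (hg.sub hf) <| by
    filter_upwards [self_mem_nhdsWithin] with z hz
    linarith [hle z hz]
  rw [riemGrad_sub hg hf, sub_eq_zero] at h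
  exact h.symm

theorem tangentProj_apply_congr {x G H : State M N} {α : Fin S}
    (h : ∀ v, device P v = α → G v = H v) {v : Coord M N} (hv : device P v = α) :
    tangentProj x G v = tangentProj x H v := by
  rcases v with ⟨i, ⟨a, b⟩ | c⟩ | w
  · have : rot G i = rot H i := by ext a b; exact h _ hv
    simp only [tangentProj, this]
  · exact h _ hv
  · exact h _ hv

/-! ### Local solutions -/

/-- Being a local solution depends on the own block only. -/
theorem IsLocalSolution.congr {ξ : ℝ} {α : Fin S} {y z x : State M N}
    (h : IsLocalSolution P ξ α y z) (hx : x ∈ feasible M N) (hs : SameBlock P α x z) :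
    IsLocalSolution P ξ α y x := by
  refine ⟨hx, ?_⟩
  -- The map `π` keeps block `α` and takes all other blocks from `z`. It is continuous, preserves
  -- feasibility and sends `x` to `z`, so local minimality at `z` pulls back to `x`.
  let π : State M N → State M N := fun v =>
    WithLp.toLp 2 fun c => if device P c = α then v c else z c
  have hπc : Continuous π := by
    refine (PiLp.continuous_toLp 2 _).comp (continuous_pi fun c => ?_)
    by_cases hc : device P c = α
    · simp only [hc, if_true]; fun_prop
    · simp only [hc, if_false]; fun_prop
  have hπs : ∀ v, SameBlock P α v (π v) := fun v c hc => by simp [π, hc]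
  have hπx : π x = z := by
    ext c
    by_cases hc : device P c = α
    · simp [π, hc, hs c hc]
    · simp [π, hc]
  have hπm : ∀ v ∈ feasible M N, π v ∈ feasible M N := by
    intro v hv i
    by_cases hi : P.camDev i = α
    · have : rot (π v) i = rot v i := by ext a b; simp [rot, π, device, hi]
      rw [this]; exact hv i
    · have : rot (π v) i = rot z i := by ext a b; simp [rot, π, device, hi]
      rw [this]; exact h.1 i
  have ht : Tendsto π (𝓝[feasible M N] x) (𝓝[feasible M N] z) := by
    refine tendsto_nhdsWithin_iff.2 ⟨?_, ?_⟩
    · rw [← hπx]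
      exact hπc.continuousAt.tendsto.mono_left nhdsWithin_le_nhds
    · filter_upwards [self_mem_nhdsWithin] with v hv using hπm v hv
  filter_upwards [ht.eventually h.2] with v hv
  rw [surrogate_congr P ξ α y hs, surrogate_congr P ξ α y (hπs v)]
  exact hv

/-- A base point from which device `α` has obtained its next block in step `k`. -/
theorem IsRun.exists_base {ξ η : ℝ} {x xbar cand : ℕ → State M N}
    (h : IsRun P ξ η x xbar cand) (α : Fin S) (k : ℕ) :
    ∃ y, (y = xbar k ∨ y = x k) ∧ IsLocalSolution P ξ α y (x (k + 1)) := by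
  rcases le_or_gt (trialE P ξ x α k (cand k)) (metricFbar P ξ η x α k) with hc | hc
  · exact ⟨xbar k, Or.inl rfl, (h.solve k α).congr P (h.mem_feasible _) (h.keep k α hc)⟩
  · exact ⟨x k, Or.inr rfl, (h.restart k α hc).1⟩

/-! ### The extrapolated points -/

theorem one_le_nesterovS (k : ℕ) : 1 ≤ nesterovS k := by
  cases k with
  | zero => exact le_rfl
  | succ k =>
    have : (1 : ℝ) ≤ Real.sqrt (4 * nesterovS k ^ 2 + 1) := by
      rw [Real.one_le_sqrt]; nlinarith [sq_nonneg (nesterovS k)]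
    simp only [nesterovS]; linarith

/-- Only the boundedness of the momentum ratio matters for convergence. -/
theorem nesterovGamma_mem (k : ℕ) : 0 ≤ nesterovGamma k ∧ nesterovGamma k ≤ 1 := by
  have h1 := one_le_nesterovS k
  have h2 := one_le_nesterovS (k + 1)
  have h3 : nesterovS k ≤ nesterovS (k + 1) := by
    have : 2 * nesterovS k ≤ Real.sqrt (4 * nesterovS k ^ 2 + 1) :=
      Real.le_sqrt_of_sq_le (by nlinarith)
    simp only [nesterovS]; linarith
  refine ⟨div_nonneg (by linarith) (by linarith), ?_⟩
  exact div_le_one_of_le₀ (by linarith) (by linarith)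

theorem sq_apply_le_frobSq (A : Matrix (Fin 3) (Fin 3) ℝ) (a b : Fin 3) :
    A a b ^ 2 ≤ frobSq A :=
  (Finset.single_le_sum (f := fun b => A a b ^ 2) (fun _ _ => sq_nonneg _)
    (Finset.mem_univ b)).trans
  (Finset.single_le_sum (f := fun a => ∑ b, A a b ^ 2)
    (fun _ _ => Finset.sum_nonneg fun _ _ => sq_nonneg _) (Finset.mem_univ a))

/-- With `D` the momentum in a rotation block, the current rotation lies at distance `‖D‖` from the
extrapolated matrix, so its nearest rotation is no farther. The two rotations are therefore within
`2‖D‖`, which gives the factor `4` after squaring. -/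
theorem IsExtrapolation.tendsto {γ : ℕ → ℝ} {y' y z : ℕ → State M N}
    (hγ : ∀ k, 0 ≤ γ k ∧ γ k ≤ 1) (hy : ∀ k, y k ∈ feasible M N)
    (h : ∀ k, IsExtrapolation (γ k) (y' k) (y k) (z k))
    (hlim : ∀ v, Tendsto (fun k => y k v - y' k v) atTop (𝓝 0)) (v : Coord M N) :
    Tendsto (fun k => z k v - y k v) atTop (𝓝 0) := by
  have hmul : ∀ v, Tendsto (fun k => γ k * (y k v - y' k v)) atTop (𝓝 0) := fun v => by
    refine squeeze_zero_norm (fun k => ?_) (tendsto_norm_zero.comp (hlim v))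
    rw [norm_mul, Real.norm_of_nonneg (hγ k).1]
    exact mul_le_of_le_one_left (norm_nonneg _) (hγ k).2
  rcases v with ⟨i, ⟨a, b⟩ | c | c⟩ | ⟨j, a⟩
  · have h1 : Tendsto (fun k => frobSq (γ k • (rot (y k) i - rot (y' k) i))) atTop (𝓝 0) := by
      have : Tendsto (fun k => ∑ a, ∑ b, (γ k * (y k (Sum.inl (i, Sum.inl (a, b)))
          - y' k (Sum.inl (i, Sum.inl (a, b))))) ^ 2) atTop
          (𝓝 (∑ _ : Fin 3, ∑ _ : Fin 3, (0 : ℝ) ^ 2)) :=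
        tendsto_finsetSum _ fun a _ => tendsto_finsetSum _ fun b _ => (hmul _).pow 2
      simpa [frobSq, rot] using this
    have h2 : ∀ k, (z k (Sum.inl (i, Sum.inl (a, b))) - y k (Sum.inl (i, Sum.inl (a, b)))) ^ 2
        ≤ 4 * frobSq (γ k • (rot (y k) i - rot (y' k) i)) := by
      intro k
      set D := γ k • (rot (y k) i - rot (y' k) i) with hD
      have h3 := ((h k).rot_eq i).2 (rot (y k) i) (hy k i)
      rw [← hD] at h3
      have h4 : frobSq (rot (y k) i - (rot (y k) i + D)) = frobSq D := by simp [frobSq]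
      have h5 := (sq_apply_le_frobSq (rot (z k) i - (rot (y k) i + D)) a b).trans
        (h3.trans h4.le)
      have h6 := sq_apply_le_frobSq D a b
      have h7 : z k (Sum.inl (i, Sum.inl (a, b))) - y k (Sum.inl (i, Sum.inl (a, b)))
        = (rot (z k) i - (rot (y k) i + D)) a b + D a b := by
        simp only [rot, Matrix.sub_apply, Matrix.add_apply, Matrix.of_apply]
        ring
      rw [h7]
      nlinarith [sq_nonneg ((rot (z k) i - (rot (y k) i + D)) a b - D a b)]
    have h8 := squeeze_zero (fun k => sq_nonneg _) h2 (by simpa using h1.const_mul 4)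
    have h9 := h8.sqrt
    rw [Real.sqrt_zero] at h9
    refine tendsto_zero_iff_abs_tendsto_zero _ |>.2 (h9.congr fun k => ?_)
    exact Real.sqrt_sq_eq_abs _
  · refine (hmul (Sum.inl (i, Sum.inr (Sum.inl c)))).congr fun k => ?_
    have := congrFun ((h k).trans_eq i) c
    simp [trans] at this
    rw [this]; ring
  · refine (hmul (Sum.inl (i, Sum.inr (Sum.inr c)))).congr fun k => ?_
    have := congrFun ((h k).intr_eq i) c
    simp [intr] at this
    rw [this]; ring
  · refine (hmul (Sum.inr (j, a))).congr fun k => ?_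
    have := congrFun ((h k).pt_eq j) a
    simp [pt] at this
    rw [this]; ring

/-! ### Differentiability -/

@[fun_prop]
theorem differentiable_rot (i : Fin M) (a b : Fin 3) :
    Differentiable ℝ fun z : State M N => rot z i a b := by
  simp only [rot, Matrix.of_apply]; fun_prop

@[fun_prop]
theorem differentiable_trans (i : Fin M) (a : Fin 3) :
    Differentiable ℝ fun z : State M N => trans z i a := by
  simp only [trans]; fun_prop

@[fun_prop]
theorem differentiable_pt (j : Fin N) (a : Fin 3) :
    Differentiable ℝ fun z : State M N => pt z j a := by
  simp only [pt]; fun_prop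

@[fun_prop]
theorem differentiable_ray (i : Fin M) (j : Fin N) (a : Fin 3) :
    Differentiable ℝ fun z : State M N => ray P z i j a := by
  fin_cases a
  · exact differentiable_const _
  · exact differentiable_const _
  · simp only [ray, intr, Fin.reduceFinMk, Matrix.cons_val]; fun_prop

@[fun_prop]
theorem differentiable_rotRay (i : Fin M) (j : Fin N) (a : Fin 3) :
    Differentiable ℝ fun z : State M N => rotRay P z i j a := by
  simp only [rotRay, Matrix.mulVec, dotProduct]; fun_prop

theorem differentiable_camSurrogate (y : State M N) (i : Fin M) (j : Fin N) :
    Differentiable ℝ fun z => camSurrogate P z y i j := by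
  have h := differentiable_rotRay P i j
  simp only [rotRay] at h
  simp only [camSurrogate, sqNorm, Pi.sub_apply, Pi.add_apply, Pi.smul_apply, smul_eq_mul]
  fun_prop

theorem differentiable_ptSurrogate (y : State M N) (i : Fin M) (j : Fin N) :
    Differentiable ℝ fun z => ptSurrogate P z y i j := by
  simp only [ptSurrogate, sqNorm, Pi.sub_apply, Pi.smul_apply, smul_eq_mul]
  fun_prop

theorem differentiable_blockDistSq (α : Fin S) (y : State M N) :
    Differentiable ℝ fun z => blockDistSq P α z y := by
  simp only [blockDistSq]
  fun_prop

theorem differentiableAt_pairCost (hl : IsRobustLoss P.loss) {x : State M N} {i : Fin M}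
    {j : Fin N} (h : pt x j - trans x i ≠ 0) :
    DifferentiableAt ℝ (fun z => pairCost P z i j) x := by
  have hs : DifferentiableAt ℝ (fun z => scale P z i j) x := by
    have h1 := differentiable_rotRay P i j
    simp only [rotRay] at h1
    unfold scale
    simp only [div_eq_mul_inv]
    refine DifferentiableAt.fun_mul ?_ (DifferentiableAt.fun_inv ?_
      fun h0 => h (sqNorm_eq_zero.1 h0))
    · simp only [dotProduct, Pi.sub_apply]; fun_prop
    · simp only [sqNorm, Pi.sub_apply]; fun_prop
  have he : DifferentiableAt ℝ (fun z => sqNorm (err P z i j)) x := by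
    simp only [err_eq, sqNorm, Pi.sub_apply, Pi.smul_apply, smul_eq_mul, Matrix.mulVec,
      dotProduct, Matrix.transpose_apply]
    fun_prop
  -- At `0` the loss is differentiable from the right only; this suffices because `‖e‖²` is never
  -- negative.
  have hd := (hl.differentiable _ (sqNorm_nonneg (err P x i j))).hasDerivWithinAt
  exact (hd.comp_hasFDerivAt x he.hasFDerivAt
    (Eventually.of_forall fun z => sqNorm_nonneg _)).differentiableAt.const_mul _

theorem differentiableAt_objective (hl : IsRobustLoss P.loss) {x : State M N}
    (h : ∀ e ∈ P.edges, pt x e.2 - trans x e.1 ≠ 0) :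
    DifferentiableAt ℝ (objective P) x :=
  DifferentiableAt.fun_sum fun e he => differentiableAt_pairCost P hl (h e he)

theorem differentiableAt_surrogate (hl : IsRobustLoss P.loss) (ξ : ℝ) (α : Fin S)
    {x : State M N} (y : State M N) (h : ∀ e ∈ P.edges, pt x e.2 - trans x e.1 ≠ 0) :
    DifferentiableAt ℝ (fun z => surrogate P ξ α z y) x := by
  unfold surrogate
  refine (((differentiable_blockDistSq P α y x).const_mul _).add ?_ |>.add ?_).add ?_
  · exact DifferentiableAt.fun_sum fun e he =>
      differentiableAt_pairCost P hl (h e (Finset.mem_filter.1 he).1)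
  · exact DifferentiableAt.fun_sum fun e _ => differentiable_camSurrogate P y _ _ x
  · exact DifferentiableAt.fun_sum fun e _ => differentiable_ptSurrogate P y _ _ x

/-! ### Gradients of the surrogates -/

theorem fderiv_apply_of_hasDerivAt_line {f : State M N → ℝ} {x h : State M N} {f' : ℝ}
    (hf : DifferentiableAt ℝ f x) (hd : HasDerivAt (fun t : ℝ => f (x + t • h)) f' 0) :
    fderiv ℝ f x h = f' := by
  rw [← hf.lineDeriv_eq_fderiv]
  exact HasLineDerivAt.lineDeriv hd

theorem hasDerivAt_affine (c d : ℝ) : HasDerivAt (fun t : ℝ => c + t * d) d 0 := by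
  simpa using ((hasDerivAt_id (0 : ℝ)).mul_const d).const_add c

/-- The change of `p_ij` along `h`. -/
noncomputable def rayDir (h : State M N) (i : Fin M) (j : Fin N) : Fin 3 → ℝ :=
  ![0, 0, intr h i 0 + intr h i 1 * ‖P.obs i j‖ ^ 2 + intr h i 2 * ‖P.obs i j‖ ^ 4]

/-- The derivative of `R_i p_ij` along `h`. -/
noncomputable def rotRayDir (x h : State M N) (i : Fin M) (j : Fin N) (a : Fin 3) : ℝ :=
  ∑ b, (rot h i a b * ray P x i j b + rot x i a b * rayDir P h i j b)

/-- The residual in the camera part of the surrogate. -/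
noncomputable def camResidual (x y : State M N) (i : Fin M) (j : Fin N) (a : Fin 3) : ℝ :=
  rotRay P x i j a + scale P y i j * trans x i a - mid P y i j a

/-- The residual in the point part of the surrogate. -/
noncomputable def ptResidual (x y : State M N) (i : Fin M) (j : Fin N) (a : Fin 3) : ℝ :=
  scale P y i j * pt x j a - mid P y i j a

theorem ray_add_smul (x h : State M N) (t : ℝ) (i : Fin M) (j : Fin N) (b : Fin 3) :
    ray P (x + t • h) i j b = ray P x i j b + t * rayDir P h i j b := by
  fin_cases b
  · simp [ray, rayDir]
  · simp [ray, rayDir]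
  · simp [ray, rayDir, intr]; ring

theorem hasDerivAt_rotRay_line (x h : State M N) (i : Fin M) (j : Fin N) (a : Fin 3) :
    HasDerivAt (fun t : ℝ => rotRay P (x + t • h) i j a) (rotRayDir P x h i j a) 0 := by
  have hr : ∀ (t : ℝ) (b : Fin 3), rot (x + t • h) i a b = rot x i a b + t * rot h i a b :=
    fun t b => by simp [rot]
  simp only [rotRay, Matrix.mulVec, dotProduct, hr, ray_add_smul, rotRayDir]
  refine HasDerivAt.fun_sum fun b _ => ?_
  simpa using (hasDerivAt_affine (rot x i a b) (rot h i a b)).fun_mul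
    (hasDerivAt_affine (ray P x i j b) (rayDir P h i j b))

theorem fderiv_camSurrogate (x y h : State M N) (i : Fin M) (j : Fin N) :
    fderiv ℝ (fun z => camSurrogate P z y i j) x h =
      weight P y i j * ∑ a, 2 * camResidual P x y i j a *
        (rotRayDir P x h i j a + scale P y i j * trans h i a) := by
  refine fderiv_apply_of_hasDerivAt_line (differentiable_camSurrogate P y i j x) ?_
  have h1 : ∀ a, HasDerivAt (fun t : ℝ => camResidual P (x + t • h) y i j a)
      (rotRayDir P x h i j a + scale P y i j * trans h i a) 0 := fun a => by
    have ht : ∀ t : ℝ, trans (x + t • h) i a = trans x i a + t * trans h i a :=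
      fun t => by simp [trans]
    simp only [camResidual, ht]
    exact ((hasDerivAt_rotRay_line P x h i j a).add
      ((hasDerivAt_affine _ _).const_mul _)).sub_const _
  refine HasDerivAt.add_const _ (HasDerivAt.const_mul _ (HasDerivAt.fun_sum fun a _ => ?_))
  simpa [camResidual] using (h1 a).fun_pow 2

theorem fderiv_ptSurrogate (x y h : State M N) (i : Fin M) (j : Fin N) :
    fderiv ℝ (fun z => ptSurrogate P z y i j) x h =
      weight P y i j * ∑ a, 2 * ptResidual P x y i j a * (scale P y i j * pt h j a) := by
  refine fderiv_apply_of_hasDerivAt_line (differentiable_ptSurrogate P y i j x) ?_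
  have h1 : ∀ a, HasDerivAt (fun t : ℝ => ptResidual P (x + t • h) y i j a)
      (scale P y i j * pt h j a) 0 := fun a => by
    have ht : ∀ t : ℝ, pt (x + t • h) j a = pt x j a + t * pt h j a :=
      fun t => by simp [pt]
    simp only [ptResidual, ht]
    exact ((hasDerivAt_affine _ _).const_mul _).sub_const _
  refine HasDerivAt.add_const _ (HasDerivAt.const_mul _ (HasDerivAt.fun_sum fun a _ => ?_))
  simpa [ptResidual] using (h1 a).fun_pow 2

theorem fderiv_blockDistSq (α : Fin S) (x y h : State M N) :
    fderiv ℝ (fun z => blockDistSq P α z y) x h =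
      ∑ v with device P v = α, 2 * (x v - y v) * h v := by
  refine fderiv_apply_of_hasDerivAt_line (differentiable_blockDistSq P α y x) ?_
  refine HasDerivAt.fun_sum fun v _ => ?_
  have := ((hasDerivAt_affine (x v) (h v)).sub_const (y v)).fun_pow 2
  simpa using this

/-- The costs of pairs inside a device do not depend on the base point and cancel, so no continuity
of their gradients is required. -/
theorem fderiv_surrogate_sub (hl : IsRobustLoss P.loss) (ξ : ℝ) (α : Fin S) {x : State M N}
    (y y' h : State M N) (hx : ∀ e ∈ P.edges, pt x e.2 - trans x e.1 ≠ 0) :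
    fderiv ℝ (fun z => surrogate P ξ α z y) x h - fderiv ℝ (fun z => surrogate P ξ α z y') x h =
      1 / 2 * ξ * (fderiv ℝ (fun z => blockDistSq P α z y) x h
          - fderiv ℝ (fun z => blockDistSq P α z y') x h)
        + ∑ e ∈ P.edges with P.camDev e.1 = α ∧ P.ptDev e.2 ≠ α,
          (fderiv ℝ (fun z => camSurrogate P z y e.1 e.2) x h
            - fderiv ℝ (fun z => camSurrogate P z y' e.1 e.2) x h)
        + ∑ e ∈ P.edges with P.camDev e.1 ≠ α ∧ P.ptDev e.2 = α,
          (fderiv ℝ (fun z => ptSurrogate P z y e.1 e.2) x h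
            - fderiv ℝ (fun z => ptSurrogate P z y' e.1 e.2) x h) := by
  have key : ∀ y, fderiv ℝ (fun z => surrogate P ξ α z y) x h =
      1 / 2 * ξ * fderiv ℝ (fun z => blockDistSq P α z y) x h
        + ∑ e ∈ P.edges with P.camDev e.1 = α ∧ P.ptDev e.2 = α,
          fderiv ℝ (fun z => pairCost P z e.1 e.2) x h
        + ∑ e ∈ P.edges with P.camDev e.1 = α ∧ P.ptDev e.2 ≠ α,
          fderiv ℝ (fun z => camSurrogate P z y e.1 e.2) x h
        + ∑ e ∈ P.edges with P.camDev e.1 ≠ α ∧ P.ptDev e.2 = α,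
          fderiv ℝ (fun z => ptSurrogate P z y e.1 e.2) x h := by
    intro y
    have hb := ((differentiable_blockDistSq P α y x).hasFDerivAt).const_mul (1 / 2 * ξ)
    have hF := HasFDerivAt.fun_sum
      (u := P.edges.filter fun e => P.camDev e.1 = α ∧ P.ptDev e.2 = α) fun e he =>
      (differentiableAt_pairCost P hl (hx e (Finset.mem_filter.1 he).1)).hasFDerivAt
    have hc := HasFDerivAt.fun_sum
      (u := P.edges.filter fun e => P.camDev e.1 = α ∧ P.ptDev e.2 ≠ α) fun e _ =>
      (differentiable_camSurrogate P y e.1 e.2 x).hasFDerivAt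
    have hp := HasFDerivAt.fun_sum
      (u := P.edges.filter fun e => P.camDev e.1 ≠ α ∧ P.ptDev e.2 = α) fun e _ =>
      (differentiable_ptSurrogate P y e.1 e.2 x).hasFDerivAt
    have := (((hb.add hF).add hc).add hp).fderiv
    have h2 := DFunLike.congr_fun this h
    simp only [add_apply, smul_apply, smul_eq_mul,
      sum_apply] at h2
    exact h2
  rw [key, key, Finset.sum_sub_distrib, Finset.sum_sub_distrib]
  ring

/-! ### The gradient of the objective in the block of a device -/

theorem gradient_surrogate_apply_of_ne (hl : IsRobustLoss P.loss) (ξ : ℝ) {α : Fin S}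
    {x : State M N} (y : State M N) (hx : ∀ e ∈ P.edges, pt x e.2 - trans x e.1 ≠ 0)
    {v : Coord M N} (hv : device P v ≠ α) :
    gradient (fun z => surrogate P ξ α z y) x v = 0 := by
  rw [gradient_apply]
  refine fderiv_apply_of_hasDerivAt_line (differentiableAt_surrogate P hl ξ α y hx) ?_
  refine (hasDerivAt_const (0 : ℝ) (surrogate P ξ α x y)).congr_of_eventuallyEq
    (Eventually.of_forall fun t => surrogate_congr P ξ α y fun w hw => ?_)
  have hne : w ≠ v := by rintro rfl; exact hv hw
  simp [hne]

/-- At a local solution of the subproblem of device `α` with base point `y`, the components in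
block `α` of the Riemannian gradient of the objective are those of the projected difference of two
surrogate gradients. -/
theorem riemGrad_objective_apply (hl : IsRobustLoss P.loss) {ξ : ℝ} (hξ : 0 ≤ ξ) {α : Fin S}
    {x y : State M N} (hx : ∀ e ∈ P.edges, pt x e.2 - trans x e.1 ≠ 0)
    (hsol : IsLocalSolution P ξ α y x) {v : Coord M N} (hv : device P v = α) :
    riemGrad (objective P) x v =
      tangentProj x (gradient (fun z => surrogate P ξ α z x) x
        - gradient (fun z => surrogate P ξ α z y) x) v := by
  have h1 := riemGrad_eq_of_touching hsol.1 (differentiableAt_objective P hl hx)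
    (DifferentiableAt.fun_sum fun β _ => differentiableAt_surrogate P hl ξ β x hx)
    (fun z hz => objective_le_sum_surrogate P hl hξ hz x) (sum_surrogate_self P ξ hsol.1).symm
  -- In the coordinates of `α` only the surrogate of `α` contributes to the gradient of the sum.
  have h2 : ∀ w, device P w = α →
      gradient (fun z => ∑ β, surrogate P ξ β z x) x w =
        gradient (fun z => surrogate P ξ α z x) x w := by
    intro w hw
    rw [gradient_apply, fderiv_fun_sum fun β _ => differentiableAt_surrogate P hl ξ β x hx,
      sum_apply, Finset.sum_eq_single α, gradient_apply]
    · intro β _ hβ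
      rw [← gradient_apply]
      exact gradient_surrogate_apply_of_ne P hl ξ x hx (by rw [hw]; exact hβ.symm)
    · simp
  have h3 := riemGrad_eq_zero hsol.1 (differentiableAt_surrogate P hl ξ α y hx) hsol.2
  rw [riemGrad_eq_tangentProj] at h3
  rw [h1, riemGrad_eq_tangentProj, tangentProj_apply_congr P h2 hv, tangentProj_sub, h3,
    sub_zero]

/-! ### Bounded sequences with vanishing difference -/

/-- The sequences are bounded and their difference tends to zero. -/
structure Merging (u u' : ℕ → ℝ) : Prop where
  bdd : u =O[atTop] fun _ => (1 : ℝ)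
  close : (fun k => u k - u' k) =o[atTop] fun _ => (1 : ℝ)

namespace Merging

variable {u u' v v' : ℕ → ℝ}

theorem of_abs_le {C : ℝ} (hC : ∀ k, |u k| ≤ C)
    (h : Tendsto (fun k => u k - u' k) atTop (𝓝 0)) : Merging u u' :=
  ⟨Asymptotics.IsBigO.of_bound C (Eventually.of_forall fun k => by simpa using hC k),
    (Asymptotics.isLittleO_one_iff ℝ).2 h⟩

theorem tendsto (h : Merging u u') : Tendsto (fun k => u k - u' k) atTop (𝓝 0) :=
  (Asymptotics.isLittleO_one_iff ℝ).1 h.close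

theorem of_tendsto_zero (h : Tendsto u atTop (𝓝 0)) : Merging u fun _ => 0 :=
  have h' := (Asymptotics.isLittleO_one_iff ℝ).2 h
  ⟨h'.isBigO, by simpa using h'⟩

theorem symm (h : Merging u u') : Merging u' u := by
  refine ⟨?_, ?_⟩
  · simpa using h.bdd.sub h.close.isBigO
  · simpa using h.close.neg_left

theorem refl (h : Merging u u') : Merging u u := ⟨h.bdd, by simp⟩

theorem congr (h : Merging u u') (h1 : ∀ k, u k = v k) (h2 : ∀ k, u' k = v' k) :
    Merging v v' := by
  obtain rfl : u = v := funext h1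
  obtain rfl : u' = v' := funext h2
  exact h

theorem const (c : ℝ) : Merging (fun _ => c) fun _ => c :=
  of_abs_le (C := |c|) (fun _ => le_rfl) (by simp)

theorem add (h : Merging u u') (h' : Merging v v') :
    Merging (fun k => u k + v k) fun k => u' k + v' k :=
  ⟨h.bdd.add h'.bdd, (h.close.add h'.close).congr_left fun k => by ring⟩

theorem mul (h : Merging u u') (h' : Merging v v') :
    Merging (fun k => u k * v k) fun k => u' k * v' k := by
  refine ⟨by simpa using h.bdd.mul h'.bdd, ?_⟩
  -- `uv - u'v' = (u - u') v + u' (v - v')`.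
  have h1 := h.close.mul_isBigO h'.bdd
  have h2 := h.symm.bdd.mul_isLittleO h'.close
  simp only [mul_one] at h1 h2
  exact (h1.add h2).congr_left fun k => by ring

theorem sub (h : Merging u u') (h' : Merging v v') :
    Merging (fun k => u k - v k) fun k => u' k - v' k :=
  (h.add ((const (-1)).mul h')).congr (fun k => by ring) fun k => by ring

theorem sum {ι : Type*} {s : Finset ι} {u u' : ι → ℕ → ℝ} (h : ∀ i ∈ s, Merging (u i) (u' i)) :
    Merging (fun k => ∑ i ∈ s, u i k) fun k => ∑ i ∈ s, u' i k :=
  ⟨Asymptotics.IsBigO.fun_sum fun i hi => (h i hi).bdd,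
    (Asymptotics.IsLittleO.fun_sum fun i hi => (h i hi).close).congr_left fun k => by
      rw [Finset.sum_sub_distrib]⟩

/-- Only `u` is assumed bounded away from zero; `u'` eventually exceeds `c / 2`, which makes `1 / (u
u')` bounded. -/
theorem inv {c : ℝ} (hc : 0 < c) (hu : ∀ k, c < u k)
    (h : Tendsto (fun k => u k - u' k) atTop (𝓝 0)) :
    Merging (fun k => (u k)⁻¹) fun k => (u' k)⁻¹ := by
  have hb : ∀ k, |(u k)⁻¹| ≤ c⁻¹ := fun k => by
    rw [abs_of_pos (inv_pos.2 (hc.trans (hu k)))]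
    exact inv_anti₀ hc (hu k).le
  refine of_abs_le hb ?_
  have hu' : ∀ᶠ k in atTop, c / 2 < u' k := by
    filter_upwards [h.eventually_lt_const (half_pos hc)] with k hk
    linarith [hu k]
  have hO : (fun k => (u k)⁻¹ * (u' k)⁻¹) =O[atTop] fun _ => (1 : ℝ) := by
    refine Asymptotics.IsBigO.of_bound (c⁻¹ * (c / 2)⁻¹) ?_
    filter_upwards [hu'] with k hk
    have hk0 : 0 < u' k := (half_pos hc).trans hk
    rw [norm_mul, Real.norm_eq_abs, Real.norm_eq_abs, norm_one, mul_one,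
      abs_of_pos (inv_pos.2 hk0)]
    exact mul_le_mul (hb k) (inv_anti₀ (half_pos hc) hk.le) (inv_pos.2 hk0).le
      (inv_pos.2 hc).le
  have h1 := hO.mul_isLittleO ((Asymptotics.isLittleO_one_iff ℝ).2 h)
  simp only [mul_one] at h1
  refine (((Asymptotics.isLittleO_one_iff ℝ).1 h1).neg.congr' ?_).trans_eq (by simp)
  filter_upwards [hu'] with k hk
  have hk0 : u' k ≠ 0 := ((half_pos hc).trans hk).ne'
  have hk1 : u k ≠ 0 := (hc.trans (hu k)).ne'
  field_simp
  ring

end Merging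

/-! ### Surrogates with nearby base points -/

/-- The data of a sequence of local solutions `X` with base points `Y` that approach them. -/
structure MergingStates (X Y : ℕ → State M N) : Prop where
  feasible_left : ∀ k, X k ∈ feasible M N
  close : ∀ v, Tendsto (fun k => X k v - Y k v) atTop (𝓝 0)
  sep : ∃ ε : ℝ, 0 < ε ∧ ∀ k, ∀ e ∈ P.edges, ε < eucNorm (pt (X k) e.2 - trans (X k) e.1)
  bdd : ∃ B : ℝ, ∀ k i, eucNorm (intr (X k) i) ≤ B


/-- By the reverse triangle inequality. No boundedness is asked for, since distances between cameras
and points may be unbounded. -/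
theorem tendsto_eucNorm_sub {u u' : ℕ → Fin 3 → ℝ}
    (h : ∀ a, Tendsto (fun k => u k a - u' k a) atTop (𝓝 0)) :
    Tendsto (fun k => eucNorm (u k) - eucNorm (u' k)) atTop (𝓝 0) := by
  have h1 : Tendsto (fun k => eucNorm (u k - u' k)) atTop (𝓝 0) := by
    have h2 : Tendsto (fun k => sqNorm (u k - u' k)) atTop (𝓝 (∑ _ : Fin 3, (0 : ℝ) ^ 2)) :=
      tendsto_finsetSum _ fun a _ => (h a).pow 2
    have h3 := h2.sqrt
    simp only [← sq_eucNorm, Real.sqrt_sq (eucNorm_nonneg _)] at h3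
    simpa using h3
  refine squeeze_zero_norm (fun k => ?_) h1
  exact abs_norm_sub_norm_le (WithLp.toLp 2 (u k) : EuclideanSpace ℝ (Fin 3))
    (WithLp.toLp 2 (u' k))

/-- The unit vector from the camera to the point. -/
noncomputable def bearing (x : State M N) (i : Fin M) (j : Fin N) (a : Fin 3) : ℝ :=
  (pt x j - trans x i) a * (eucNorm (pt x j - trans x i))⁻¹

theorem bearing_mul_eucNorm (x : State M N) (i : Fin M) (j : Fin N) (a : Fin 3) :
    bearing x i j a * eucNorm (pt x j - trans x i) = (pt x j - trans x i) a := by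
  rcases eq_or_ne (eucNorm (pt x j - trans x i)) 0 with h | h
  · have := abs_apply_le_eucNorm (pt x j - trans x i) a
    rw [h, abs_nonpos_iff] at this
    rw [h, this, mul_zero]
  · rw [bearing, inv_mul_cancel_right₀ h]

/-- The length of the projection of `R_i p_ij` to the bearing. -/
noncomputable def depth (x : State M N) (i : Fin M) (j : Fin N) : ℝ :=
  ∑ a, bearing x i j a * rotRay P x i j a

theorem scale_eq (x : State M N) (i : Fin M) (j : Fin N) :
    scale P x i j = depth P x i j * (eucNorm (pt x j - trans x i))⁻¹ := by
  rw [scale, ← sq_eucNorm, depth, dotProduct, Finset.sum_mul, Finset.sum_div]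
  refine Finset.sum_congr rfl fun a _ => ?_
  simp only [bearing, rotRay]
  ring

theorem scale_mul (x : State M N) (i : Fin M) (j : Fin N) (a : Fin 3) :
    scale P x i j * (pt x j - trans x i) a = depth P x i j * bearing x i j a := by
  rw [scale_eq, bearing]; ring

theorem err_apply (x : State M N) (i : Fin M) (j : Fin N) (a : Fin 3) :
    err P x i j a =
      ray P x i j a - depth P x i j * ∑ b, rot x i b a * bearing x i j b := by
  rw [err_eq, Pi.sub_apply, Pi.smul_apply, smul_eq_mul, Matrix.mulVec, dotProduct,
    Finset.mul_sum, Finset.mul_sum]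
  congr 1
  refine Finset.sum_congr rfl fun b _ => ?_
  rw [Matrix.transpose_apply, mul_left_comm, scale_mul, mul_left_comm]

/-- Translations survive only as the difference `t_x - t_y` and inside the bounded product of depth
and bearing. -/
theorem camResidual_eq (x y : State M N) (i : Fin M) (j : Fin N) (a : Fin 3) :
    camResidual P x y i j a = rotRay P x i j a - 1 / 2 * rotRay P y i j a
      + scale P y i j * (trans x i a - trans y i a)
      - 1 / 2 * (depth P y i j * bearing y i j a) := by
  rw [← scale_mul]
  simp only [camResidual, mid, Pi.add_apply, Pi.smul_apply, smul_eq_mul, Pi.sub_apply, rotRay]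
  ring

theorem ptResidual_eq (x y : State M N) (i : Fin M) (j : Fin N) (a : Fin 3) :
    ptResidual P x y i j a = scale P y i j * (pt x j a - pt y j a)
      + 1 / 2 * (depth P y i j * bearing y i j a) - 1 / 2 * rotRay P y i j a := by
  rw [← scale_mul]
  simp only [ptResidual, mid, Pi.add_apply, Pi.smul_apply, smul_eq_mul, Pi.sub_apply, rotRay]
  ring

/-! ### Stability of the surrogate data and gradients under a change of base point -/

namespace MergingStates

variable {P} {X Y : ℕ → State M N}

theorem rot (h : MergingStates P X Y) (i : Fin M) (a b : Fin 3) :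
    Merging (fun k => rot (X k) i a b) fun k => DABA.rot (Y k) i a b :=
  Merging.of_abs_le (fun k => abs_apply_le_one_of_mem_SO3 (h.feasible_left k i) a b)
    (h.close (Sum.inl (i, Sum.inl (a, b))))

theorem intr (h : MergingStates P X Y) (i : Fin M) (a : Fin 3) :
    Merging (fun k => intr (X k) i a) fun k => DABA.intr (Y k) i a :=
  have ⟨_, hB⟩ := h.bdd
  Merging.of_abs_le (fun k => (abs_apply_le_eucNorm _ a).trans (hB k i))
    (h.close (Sum.inl (i, Sum.inr (Sum.inr a))))

theorem ray (h : MergingStates P X Y) (i : Fin M) (j : Fin N) (a : Fin 3) :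
    Merging (fun k => ray P (X k) i j a) fun k => DABA.ray P (Y k) i j a := by
  fin_cases a
  · exact Merging.const (P.obs i j 0)
  · exact Merging.const (P.obs i j 1)
  · exact ((h.intr i 0).add ((h.intr i 1).mul (Merging.const _))).add
      ((h.intr i 2).mul (Merging.const _))

theorem rotRay (h : MergingStates P X Y) (i : Fin M) (j : Fin N) (a : Fin 3) :
    Merging (fun k => rotRay P (X k) i j a) fun k => DABA.rotRay P (Y k) i j a := by
  simp only [DABA.rotRay, Matrix.mulVec, dotProduct]
  exact Merging.sum fun b _ => (h.rot i a b).mul (h.ray i j b)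

theorem tendsto_diff (h : MergingStates P X Y) (i : Fin M) (j : Fin N) (a : Fin 3) :
    Tendsto (fun k => (pt (X k) j - trans (X k) i) a - (pt (Y k) j - trans (Y k) i) a) atTop
      (𝓝 0) := by
  have := (h.close (Sum.inr (j, a))).sub (h.close (Sum.inl (i, Sum.inr (Sum.inl a))))
  rw [sub_zero] at this
  refine this.congr fun k => ?_
  simp only [pt, trans, Pi.sub_apply]
  ring

theorem inv_dist (h : MergingStates P X Y) {e : Fin M × Fin N} (he : e ∈ P.edges) :
    Merging (fun k => (eucNorm (pt (X k) e.2 - trans (X k) e.1))⁻¹)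
      fun k => (eucNorm (pt (Y k) e.2 - trans (Y k) e.1))⁻¹ :=
  have ⟨_, hε, hs⟩ := h.sep
  Merging.inv hε (fun k => hs k e he) (tendsto_eucNorm_sub (h.tendsto_diff e.1 e.2))

/-- With `d = l - t`, `d/‖d‖ - d'/‖d'‖ = (d - d')/‖d‖ - (d'/‖d'‖)(‖d‖ - ‖d'‖)/‖d‖`. Neither `d` nor
`d'` has to be bounded. -/
theorem bearing (h : MergingStates P X Y) {e : Fin M × Fin N} (he : e ∈ P.edges) (a : Fin 3) :
    Merging (fun k => bearing (X k) e.1 e.2 a) fun k => DABA.bearing (Y k) e.1 e.2 a := by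
  have hle : ∀ x : State M N, |DABA.bearing x e.1 e.2 a| ≤ 1 := fun x => by
    rw [DABA.bearing, abs_mul, abs_inv, abs_of_nonneg (eucNorm_nonneg _), ← div_eq_mul_inv]
    exact div_le_one_of_le₀ (abs_apply_le_eucNorm _ a) (eucNorm_nonneg _)
  have hO : (fun k => DABA.bearing (Y k) e.1 e.2 a) =O[atTop] fun _ => (1 : ℝ) :=
    Asymptotics.IsBigO.of_bound 1 (Eventually.of_forall fun k => by simpa using hle (Y k))
  have h0 := (Asymptotics.isLittleO_one_iff ℝ).2 (h.tendsto_diff e.1 e.2 a)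
  have h1 := h0.mul_isBigO (h.inv_dist he).bdd
  have h2 := (Asymptotics.isLittleO_one_iff ℝ).2 (tendsto_eucNorm_sub (h.tendsto_diff e.1 e.2))
  have h3 := (hO.mul_isLittleO h2).mul_isBigO (h.inv_dist he).bdd
  simp only [mul_one] at h1 h3
  refine Merging.of_abs_le (fun k => hle (X k)) (((Asymptotics.isLittleO_one_iff ℝ).1
    (h1.sub h3)).congr fun k => ?_)
  obtain ⟨ε, hε, hs⟩ := h.sep
  have hX : eucNorm (pt (X k) e.2 - trans (X k) e.1) ≠ 0 := (hε.trans (hs k e he)).ne'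
  rw [← bearing_mul_eucNorm (X k), ← bearing_mul_eucNorm (Y k)]
  field_simp
  ring

theorem depth (h : MergingStates P X Y) {e : Fin M × Fin N} (he : e ∈ P.edges) :
    Merging (fun k => depth P (X k) e.1 e.2) fun k => DABA.depth P (Y k) e.1 e.2 :=
  Merging.sum fun a _ => (h.bearing he a).mul (h.rotRay e.1 e.2 a)

theorem scale (h : MergingStates P X Y) {e : Fin M × Fin N} (he : e ∈ P.edges) :
    Merging (fun k => scale P (X k) e.1 e.2) fun k => DABA.scale P (Y k) e.1 e.2 :=
  ((h.depth he).mul (h.inv_dist he)).congr (fun k => (scale_eq P (X k) e.1 e.2).symm)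
    fun k => (scale_eq P (Y k) e.1 e.2).symm

theorem sqNorm_err (h : MergingStates P X Y) {e : Fin M × Fin N} (he : e ∈ P.edges) :
    Merging (fun k => sqNorm (err P (X k) e.1 e.2)) fun k => sqNorm (err P (Y k) e.1 e.2) := by
  have h1 : ∀ a, Merging (fun k => err P (X k) e.1 e.2 a) fun k => err P (Y k) e.1 e.2 a := by
    intro a
    simp only [err_apply]
    exact (h.ray e.1 e.2 a).sub ((h.depth he).mul
      (Merging.sum fun b _ => (h.rot e.1 b a).mul (h.bearing he b)))
  simp only [sqNorm, sq]
  exact Merging.sum fun a _ => (h1 a).mul (h1 a)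

theorem weight (hl : IsRobustLoss P.loss) (h : MergingStates P X Y) {e : Fin M × Fin N}
    (he : e ∈ P.edges) :
    Merging (fun k => weight P (X k) e.1 e.2) fun k => DABA.weight P (Y k) e.1 e.2 := by
  obtain ⟨L, hL⟩ := hl.lipschitz
  refine Merging.of_abs_le (C := 1) (fun k => ?_) ?_
  · have := hl.deriv_mem _ (sqNorm_nonneg (err P (X k) e.1 e.2))
    exact abs_le.2 ⟨neg_one_lt_zero.le.trans this.1, this.2⟩
  · have h1 := (tendsto_norm_zero.comp (h.sqNorm_err he).tendsto).const_mul (L : ℝ)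
    rw [mul_zero] at h1
    refine squeeze_zero_norm (fun k => ?_) h1
    exact hL.norm_sub_le (sqNorm_nonneg _) (sqNorm_nonneg _)

theorem camResidual (h : MergingStates P X Y) {e : Fin M × Fin N} (he : e ∈ P.edges)
    (a : Fin 3) :
    Merging (fun k => camResidual P (X k) (X k) e.1 e.2 a)
      fun k => DABA.camResidual P (X k) (Y k) e.1 e.2 a := by
  simp only [camResidual_eq]
  -- With base `X` the translation difference is exactly zero, with base `Y` it is a null sequence.
  have ht := (Merging.of_tendsto_zero (h.close (Sum.inl (e.1, Sum.inr (Sum.inl a))))).symm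
  refine ((((h.rotRay e.1 e.2 a).refl.sub ((Merging.const (1 / 2)).mul (h.rotRay e.1 e.2 a))).add
    ((h.scale he).mul ht)).sub ((Merging.const (1 / 2)).mul
      ((h.depth he).mul (h.bearing he a)))).congr (fun k => ?_) fun k => rfl
  rw [sub_self]

theorem ptResidual (h : MergingStates P X Y) {e : Fin M × Fin N} (he : e ∈ P.edges)
    (a : Fin 3) :
    Merging (fun k => ptResidual P (X k) (X k) e.1 e.2 a)
      fun k => DABA.ptResidual P (X k) (Y k) e.1 e.2 a := by
  simp only [ptResidual_eq]
  have ht := (Merging.of_tendsto_zero (h.close (Sum.inr (e.2, a)))).symm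
  refine ((((h.scale he).mul ht).add ((Merging.const (1 / 2)).mul
      ((h.depth he).mul (h.bearing he a)))).sub ((Merging.const (1 / 2)).mul
      (h.rotRay e.1 e.2 a))).congr (fun k => ?_) fun k => rfl
  rw [sub_self]

theorem fderiv_camSurrogate (hl : IsRobustLoss P.loss) (h : MergingStates P X Y)
    {e : Fin M × Fin N} (he : e ∈ P.edges) (w : State M N) :
    Merging (fun k => fderiv ℝ (fun z => camSurrogate P z (X k) e.1 e.2) (X k) w)
      fun k => fderiv ℝ (fun z => camSurrogate P z (Y k) e.1 e.2) (X k) w := by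
  simp only [DABA.fderiv_camSurrogate]
  refine (h.weight hl he).mul (Merging.sum fun a _ => ?_)
  refine ((Merging.const 2).mul (h.camResidual he a)).mul
    (Merging.add ?_ ((h.scale he).mul (Merging.const _)))
  -- The direction derivative of `R p` is taken at `X k` for both bases, hence the reflexive pairs.
  exact Merging.sum fun b _ => ((Merging.const _).mul (h.ray e.1 e.2 b).refl).add
    ((h.rot e.1 a b).refl.mul (Merging.const _))

theorem fderiv_ptSurrogate (hl : IsRobustLoss P.loss) (h : MergingStates P X Y)
    {e : Fin M × Fin N} (he : e ∈ P.edges) (w : State M N) :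
    Merging (fun k => fderiv ℝ (fun z => ptSurrogate P z (X k) e.1 e.2) (X k) w)
      fun k => fderiv ℝ (fun z => ptSurrogate P z (Y k) e.1 e.2) (X k) w := by
  simp only [DABA.fderiv_ptSurrogate]
  exact (h.weight hl he).mul (Merging.sum fun a _ => ((Merging.const 2).mul
    (h.ptResidual he a)).mul ((h.scale he).mul (Merging.const _)))

theorem fderiv_blockDistSq (h : MergingStates P X Y) (α : Fin S) (w : State M N) :
    Merging (fun k => fderiv ℝ (fun z => blockDistSq P α z (X k)) (X k) w)
      fun k => fderiv ℝ (fun z => blockDistSq P α z (Y k)) (X k) w := by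
  simp only [DABA.fderiv_blockDistSq]
  refine Merging.sum fun v _ => ((Merging.const 2).mul ?_).mul (Merging.const _)
  exact (Merging.of_tendsto_zero (h.close v)).symm.congr (fun k => (sub_self _).symm)
    fun k => rfl

theorem pt_sub_trans_ne_zero (h : MergingStates P X Y) (k : ℕ) :
    ∀ e ∈ P.edges, pt (X k) e.2 - trans (X k) e.1 ≠ 0 := by
  intro e he h0
  obtain ⟨ε, hε, hs⟩ := h.sep
  have := hs k e he
  rw [h0] at this
  simp [eucNorm] at this
  linarith

theorem tendsto_gradient_sub (hl : IsRobustLoss P.loss) (h : MergingStates P X Y) (ξ : ℝ)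
    (α : Fin S) (v : Coord M N) :
    Tendsto (fun k => (gradient (fun z => surrogate P ξ α z (X k)) (X k)
      - gradient (fun z => surrogate P ξ α z (Y k)) (X k)) v) atTop (𝓝 0) := by
  simp only [PiLp.sub_apply, gradient_apply,
    fderiv_surrogate_sub P hl ξ α _ _ _ (h.pt_sub_trans_ne_zero _)]
  have hb := (h.fderiv_blockDistSq α (basisVec v)).tendsto.const_mul (1 / 2 * ξ)
  have hc := tendsto_finsetSum (P.edges.filter fun e => P.camDev e.1 = α ∧ P.ptDev e.2 ≠ α)
    fun e he => (h.fderiv_camSurrogate hl (Finset.mem_filter.1 he).1 (basisVec v)).tendsto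
  have hp := tendsto_finsetSum (P.edges.filter fun e => P.camDev e.1 ≠ α ∧ P.ptDev e.2 = α)
    fun e he => (h.fderiv_ptSurrogate hl (Finset.mem_filter.1 he).1 (basisVec v)).tendsto
  simpa using (hb.add hc).add hp

theorem tendsto_tangentProj (h : MergingStates P X Y) {G : ℕ → State M N}
    (hG : ∀ v, Tendsto (fun k => G k v) atTop (𝓝 0)) (v : Coord M N) :
    Tendsto (fun k => tangentProj (X k) (G k) v) atTop (𝓝 0) := by
  rcases v with ⟨i, ⟨a, b⟩ | c⟩ | w
  · have hm : ∀ c d, Merging (fun k => DABA.rot (G k) i c d) fun _ => 0 :=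
      fun c d => Merging.of_tendsto_zero (hG (Sum.inl (i, Sum.inl (c, d))))
    have := ((Merging.const (1 / 2)).mul (hm a b)).sub ((Merging.const (1 / 2)).mul
      (Merging.sum fun c (_ : c ∈ Finset.univ) => (Merging.sum fun d (_ : d ∈ Finset.univ) =>
        (h.rot i a d).refl.mul (hm c d)).mul (h.rot i c b).refl))
    simpa [tangentProj, Matrix.mul_apply] using this.tendsto
  · exact hG _
  · exact hG _

/-- If every `X k` is a local solution of the subproblem of device `α` with base point `Y k`, the
components in block `α` of the Riemannian gradient of the objective tend to zero. -/
theorem tendsto_riemGrad_apply (hl : IsRobustLoss P.loss) (h : MergingStates P X Y) {ξ : ℝ}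
    (hξ : 0 ≤ ξ) {α : Fin S} (hsol : ∀ k, IsLocalSolution P ξ α (Y k) (X k)) {v : Coord M N}
    (hv : device P v = α) :
    Tendsto (fun k => riemGrad (objective P) (X k) v) atTop (𝓝 0) := by
  simp only [fun k => riemGrad_objective_apply P hl hξ (h.pt_sub_trans_ne_zero k) (hsol k) hv]
  exact h.tendsto_tangentProj (h.tendsto_gradient_sub hl ξ α) v

end MergingStates

/-! ### From coordinates to the full gradient along a run -/

theorem tendsto_state_zero {G : ℕ → State M N} (h : ∀ v, Tendsto (fun k => G k v) atTop (𝓝 0)) :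
    Tendsto G atTop (𝓝 0) :=
  ((PiLp.continuous_toLp 2 fun _ : Coord M N => ℝ).tendsto 0).comp (tendsto_pi_nhds.2 h)

theorem tendsto_state_apply {G : ℕ → State M N} (h : Tendsto G atTop (𝓝 0)) (v : Coord M N) :
    Tendsto (fun k => G k v) atTop (𝓝 0) :=
  (((EuclideanSpace.proj v : State M N →L[ℝ] ℝ).continuous.tendsto 0).comp h)

variable {P} in
theorem IsRun.tendsto_extrapolated_sub {ξ η : ℝ} {x xbar cand : ℕ → State M N}
    (h : IsRun P ξ η x xbar cand)
    (hstep : ∀ v, Tendsto (fun k => x (k + 1) v - x k v) atTop (𝓝 0)) (v : Coord M N) :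
    Tendsto (fun k => xbar k v - x k v) atTop (𝓝 0) := by
  refine IsExtrapolation.tendsto nesterovGamma_mem h.mem_feasible h.extrapolate (fun v => ?_) v
  -- The shift discards `k = 0`, where the predecessor is `x 0` by truncation.
  rw [← tendsto_add_atTop_iff_nat 1]
  simpa using hstep v

end DABA

theorem proposition3 {M N S : ℕ} (P : DABA.Problem M N S)
    (ξ η : ℝ) (hξ : 0 < ξ) (hη0 : 0 < η) (hη1 : η ≤ 1)
    (hloss : DABA.IsRobustLoss P.loss)
    (x xbar cand : ℕ → DABA.State M N)
    (hrun : DABA.IsRun P ξ η x xbar cand)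
    (hsep : ∃ ε : ℝ, 0 < ε ∧ ∀ k, ∀ e ∈ P.edges,
      ε < DABA.eucNorm (DABA.pt (x k) e.2 - DABA.trans (x k) e.1))
    (hbdd : ∃ B : ℝ, ∀ k i, DABA.eucNorm (DABA.intr (x k) i) ≤ B) :
    (∀ k, DifferentiableAt ℝ (DABA.objective P) (x k)) ∧
      Tendsto (fun k => DABA.riemGrad (DABA.objective P) (x k)) atTop (𝓝 0) := by
  have hstep := DABA.tendsto_state_apply (hrun.tendsto_step hloss hξ hη0 hη1)
  simp only [PiLp.sub_apply] at hstep
  have hbar := hrun.tendsto_extrapolated_sub hstep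
  refine ⟨fun k => DABA.differentiableAt_objective P hloss ?_, ?_⟩
  · have hm : DABA.MergingStates P x x := ⟨hrun.mem_feasible, by simp, hsep, hbdd⟩
    exact hm.pt_sub_trans_ne_zero k
  -- The initial point solves no subproblem; first-order conditions hold from `x 1` on.
  rw [← tendsto_add_atTop_iff_nat 1]
  refine DABA.tendsto_state_zero fun v => ?_
  -- Acceptance and restart may alternate, so the base is chosen anew for every `k`, for the device
  -- that holds `v`.
  choose y hy hsol using hrun.exists_base P (DABA.device P v)
  obtain ⟨ε, hε, hs⟩ := hsep
  obtain ⟨B, hB⟩ := hbdd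
  have hm : DABA.MergingStates P (fun k => x (k + 1)) y := by
    refine ⟨fun k => hrun.mem_feasible _, fun w => ?_, ⟨ε, hε, fun k => hs _⟩,
      ⟨B, fun k => hB _⟩⟩
    -- The sum of the step and the extrapolation offset bounds the distance to either possible base.
    have h1 := (hstep w).abs.add (hbar w).abs
    rw [abs_zero, add_zero] at h1
    refine squeeze_zero_norm (fun k => ?_) h1
    rcases hy k with h | h <;> rw [h, Real.norm_eq_abs]
    · have := abs_sub (x (k + 1) w - x k w) (xbar k w - x k w)
      rwa [sub_sub_sub_cancel_right] at this
    · linarith [abs_nonneg (xbar k w - x k w)]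
  exact hm.tendsto_riemGrad_apply hloss hξ.le hsol rfl
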